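/- **Setting.** There are $n$ jobs $J=\{1,\dots,n\}$ with processing times $p_j>0$ and weights $w_j>0$. A schedule is an order of all jobs, processed without idle time from time $0$; $t_j$ is the start time and $C_j=t_j+p_j$ the completion time of job $j$. The airplane refueling problem asks for a schedule minimizing $\sum_j -w_j/C_j$. **Potential schedules.** Put $\varphi_j(t)=\dfrac{w_j}{p_j(p_j+t)}$ and $t^*_{ij}=\dfrac{w_jp_i^2-w_ip_j^2}{w_ip_j-w_jp_i}$ (with $t^*_{ij}=0$ if the denominator vanishes). The dominance rule consists of the following relations, for all jobs $i,j$ with $w_i<w_j$: (1) if $\varphi_i(t)\ge\varphi_j(t)$ for all $t\ge 0$, then $i\prec_{g[0,\infty)}j$; (2) if $\varphi_j(t)\ge\varphi_i(t)$ for all $t\ge0$, then $j\prec_{g[0,\infty)}i$; (3) otherwise $i\prec_{g[0,t^*_{ij})}j$ and $j\prec_{g[t^*_{ij},\infty)}i$. A schedule violates $i\prec_{g\,I}j$ if $t_j\le t_i-p_j$ and both $t_j$ and $t_i-p_j$ lie in $I$. A potential schedule is a schedule that violates no relation of the rule; $K$ is the number of potential schedules. **Algorithm.** First all $t^*_{ij}$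 and $c_{ij}=t^*_{ij}+p_j$ are computed and, for every $i$, the jobs $j$ are sorted by $t^*_{ij}$ and by $c_{ij}$. Then $\mathrm{FastSchedule}(J,0)$ is called. The call $\mathrm{FastSchedule}(J',t)$ returns a value and a sequence of the jobs of $J'$: if $J'=\emptyset$, it returns $0$ and the empty sequence; if $J'=\{j\}$, it returns $w_j/(p_j+t)$ and $[j]$. Otherwise put $t_e=t+\sum_{j\in J'}p_j$ and let $\alpha\in J'$ have maximum $\varphi_\alpha(t)$, ties being broken by maximum $\varphi_\alpha(t_e)$. Let $c_1=t$, followed in nondecreasing order by the $c_{\alpha j}$ of the jobs $j\in J'\setminus\{\alpha\}$ with $t^*_{\alpha j}\in(t,t_e)$ and $c_{\alpha j}<t_e$, and finally $t_e$. For each $q$ with a successor $c_{q+1}$, let $J_l$ be the set of the jobs whose $c_{\alpha j}$ is among $c_2,\dots,c_q$, let $J_r=J'\setminus(J_l\cup\{\alpha\})$ and $t_\alpha=t+\sum_{j\in J_l}p_j$. If $c_q\le t_\alpha<c_{q+1}$ and $t_\alpha$ lies in none of the banned intervals $[t^*_{\alpha j},c_{\alpha j})$ with $j\in J'\setminus\{\alpha\}$,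 $t^*_{\alpha j}\in(t,t_e)$, then $t_\alpha$ is a possible start time of $\alpha$ and a branch is opened: the algorithm solves $(J_l,t)$ and $(J_r,t_\alpha+p_\alpha)$ recursively and combines the results into the sequence $[\mathrm{seq}_l,\alpha,\mathrm{seq}_r]$ with value $\mathrm{opt}_l+\mathrm{opt}_r+w_\alpha/(p_\alpha+t_\alpha)$. The best branch is returned. Time is counted in unit-cost steps on real numbers (arithmetic operations, comparisons, array accesses, list and control steps). **Theorem.** 1. For every instance the algorithm returns an optimal schedule together with its value $\sum_j w_j/C_j$. 2. There is an absolute constant $C$ such that for every instance with $n\ge1$ jobs the whole computation takes at most $C\,n^2(\log n+K)$ steps; computing and sorting all $t^*_{ij}$ (and $c_{ij}$) takes at most $C\,n^2\log n$ steps if $n\ge 2$; and, after that, for every nonempty job set $J'\subseteq J$ and every $t$, all possible start times of $\alpha$ in the subproblem $(J',t)$ are found in at most $C\,n$ steps. 3. Every branch explored by the algorithm contains a potential schedule: whenever a recursive call opens a branch, there is a potential schedule of all $n$ jobs that agrees with this branch and with all branches leading to that call, where agreeing with a branch means that the jobs of $J_l$, then $\alpha$ at time $t_\alpha$, then the jobs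 of $J_r$ are processed consecutively. -/

import Mathlib

/-! Scheduling side: jobs are the elements of `Fin n`; a (partial) schedule is the list of its jobs in
processing order, processed without idle time from a given start time. -/

namespace Refueling

noncomputable section

/-- Auxiliary function `φ_j(t) = w_j / (p_j (p_j + t))`. -/
def phi {n : ℕ} (w p : Fin n → ℝ) (j : Fin n) (t : ℝ) : ℝ := w j / (p j * (p j + t))

/-- `t*_{ij}`, the time at which `φ_i` and `φ_j` cross (where they do). -/
def tstar {n : ℕ} (w p : Fin n → ℝ) (i j : Fin n) : ℝ :=
  (w j * p i ^ 2 - w i * p j ^ 2) / (w i * p j - w j * p i)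

/-- Start time of job `j` in the schedule `S` that begins at time `t`. -/
def startTime {n : ℕ} (p : Fin n → ℝ) (t : ℝ) (S : List (Fin n)) (j : Fin n) : ℝ :=
  t + ((S.take (S.idxOf j)).map p).sum

/-- Completion time of job `j` in the schedule `S` that begins at time `t`. -/
def completionTime {n : ℕ} (p : Fin n → ℝ) (t : ℝ) (S : List (Fin n)) (j : Fin n) : ℝ :=
  startTime p t S j + p j

/-- The cost `∑ -w_j / C_j` (to be minimised) of the schedule `S` begun at time `t`. -/
def cost {n : ℕ} (w p : Fin n → ℝ) (t : ℝ) (S : List (Fin n)) : ℝ :=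
  (S.map fun j => -w j / completionTime p t S j).sum

/-- Complete schedules: every job occurs exactly once. -/
def IsSchedule {n : ℕ} (S : List (Fin n)) : Prop := S.Perm (List.finRange n)

/-- Optimal solutions of `1 || ∑ w_j (-1/C_j)`. -/
def IsOptimal {n : ℕ} (w p : Fin n → ℝ) (S : List (Fin n)) : Prop :=
  IsSchedule S ∧ ∀ S' : List (Fin n), IsSchedule S' → cost w p 0 S ≤ cost w p 0 S'

/-- The dominance rule: `Rule w p i j I` says that the rule contains `i ≺_{g I} j`. -/
inductive Rule {n : ℕ} (w p : Fin n → ℝ) : Fin n → Fin n → Set ℝ → Prop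
  | first (i j : Fin n) (hw : w i < w j) (h : ∀ t, 0 ≤ t → phi w p j t ≤ phi w p i t) :
      Rule w p i j (Set.Ici 0)
  | second (i j : Fin n) (hw : w i < w j) (h : ∀ t, 0 ≤ t → phi w p i t ≤ phi w p j t) :
      Rule w p j i (Set.Ici 0)
  | early (i j : Fin n) (hw : w i < w j) (h₁ : ¬ ∀ t, 0 ≤ t → phi w p j t ≤ phi w p i t)
      (h₂ : ¬ ∀ t, 0 ≤ t → phi w p i t ≤ phi w p j t) :
      Rule w p i j (Set.Ico 0 (tstar w p i j))
  | late (i j : Fin n) (hw : w i < w j) (h₁ : ¬ ∀ t, 0 ≤ t → phi w p j t ≤ phi w p i t)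
      (h₂ : ¬ ∀ t, 0 ≤ t → phi w p i t ≤ phi w p j t) :
      Rule w p j i (Set.Ici (tstar w p i j))

/-- The schedule `S` begun at time `t` violates `i ≺_{g I} j`: job `j` precedes job `i`, and both
`t_j` and `t_i - p_j` lie in the time interval `I`. -/
def Violates {n : ℕ} (p : Fin n → ℝ) (t : ℝ) (S : List (Fin n)) (i j : Fin n) (I : Set ℝ) : Prop :=
  i ∈ S ∧ j ∈ S ∧ startTime p t S j ≤ startTime p t S i - p j ∧
    startTime p t S j ∈ I ∧ startTime p t S i - p j ∈ I

/-- (Partial) potential schedules: no relation of the dominance rule is violated. -/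
def IsPotential {n : ℕ} (w p : Fin n → ℝ) (t : ℝ) (S : List (Fin n)) : Prop :=
  ∀ i j I, Rule w p i j I → ¬ Violates p t S i j I

/-- `K`, the number of complete potential schedules. -/
def numPotential {n : ℕ} (w p : Fin n → ℝ) : ℕ :=
  Set.ncard {S : List (Fin n) | IsSchedule S ∧ IsPotential w p 0 S}

/-! Computation model: a real RAM with unit costs. A value of `Timed β` is a result together with the
number of elementary steps spent on it. An elementary step is one arithmetic operation or comparison
of two reals, one comparison of two job indices, one access to an array, or one `tick`, which pays for
a function call or a loop iteration together with a bounded number of list constructions and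
decompositions. Programs below manipulate reals, indices and arrays through these operations only. -/

/-- A result together with the number of elementary steps spent on it. -/
structure Timed (β : Type) where
  val : β
  time : ℕ

instance : Monad Timed where
  pure a := ⟨a, 0⟩
  bind x f := ⟨(f x.val).val, x.time + (f x.val).time⟩

def tick : Timed Unit := ⟨(), 1⟩
def addR (a b : ℝ) : Timed ℝ := ⟨a + b, 1⟩
def subR (a b : ℝ) : Timed ℝ := ⟨a - b, 1⟩
def mulR (a b : ℝ) : Timed ℝ := ⟨a * b, 1⟩
def divR (a b : ℝ) : Timed ℝ := ⟨a / b, 1⟩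
def ltR (a b : ℝ) : Timed Bool := ⟨decide (a < b), 1⟩
def leR (a b : ℝ) : Timed Bool := ⟨decide (a ≤ b), 1⟩
def eqR (a b : ℝ) : Timed Bool := ⟨decide (a = b), 1⟩
def eqIdx {n : ℕ} (i j : Fin n) : Timed Bool := ⟨decide (i = j), 1⟩
/-- Arrays of length `n` are functions on `Fin n`. -/
def read {n : ℕ} {β : Type} (a : Fin n → β) (i : Fin n) : Timed β := ⟨a i, 1⟩
def write {n : ℕ} {β : Type} (a : Fin n → β) (i : Fin n) (b : β) : Timed (Fin n → β) :=
  ⟨Function.update a i b, 1⟩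
/-- Fill a new array of length `n`: pay for every entry and for writing it. -/
def fill {n : ℕ} {β : Type} (f : Fin n → Timed β) : Timed (Fin n → β) :=
  ⟨fun i => (f i).val, 1 + ∑ i, ((f i).time + 1)⟩
/-- The list of all `n` jobs. -/
def allJobs (n : ℕ) : Timed (List (Fin n)) := ⟨List.finRange n, n + 1⟩

/-- Select the list elements that pass a test. -/
def select {β : Type} (test : β → Timed Bool) : List β → Timed (List β)
  | [] => do tick; return []
  | a :: l => do
      tick
      let b ← test a
      let r ← select test l
      if b then return a :: r else return r

/-- Concatenation of lists, linear in the length of the first. -/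
def append {β : Type} : List β → List β → Timed (List β)
  | [], l => do tick; return l
  | a :: k, l => do
      tick
      let r ← append k l
      return a :: r

/-- Split a list into two halves. -/
def split {β : Type} : List β → Timed (List β × List β)
  | [] => do tick; return ([], [])
  | a :: l => do
      tick
      let r ← split l
      return (a :: r.2, r.1)

/-- Merge two lists sorted by `key`. -/
def merge {n : ℕ} (key : Fin n → ℝ) : List (Fin n) → List (Fin n) → Timed (List (Fin n))
  | [], l => do tick; return l
  | a :: k, [] => do tick; return a :: k
  | a :: k, b :: l => do
      tick
      let x ← read key a
      let y ← read key b
      if ← leR x y then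
        let r ← merge key k (b :: l)
        return a :: r
      else
        let r ← merge key (a :: k) l
        return b :: r
  termination_by k l => k.length + l.length

/-- Merge sort by `key`. The first argument bounds the recursion depth; the length of the list is
always enough. -/
def mergeSort {n : ℕ} (key : Fin n → ℝ) : ℕ → List (Fin n) → Timed (List (Fin n))
  | 0, l => do tick; return l
  | _ + 1, [] => do tick; return []
  | _ + 1, [a] => do tick; return [a]
  | d + 1, a :: b :: l => do
      tick
      let r ← split (a :: b :: l)
      let x ← mergeSort key d r.1
      let y ← mergeSort key d r.2
      merge key x y

/-! The algorithm. -/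

/-- Compute `φ_j(t)`. -/
def evalPhi {n : ℕ} (w p : Fin n → ℝ) (j : Fin n) (t : ℝ) : Timed ℝ := do
  tick
  let wj ← read w j
  let pj ← read p j
  let s ← addR pj t
  let d ← mulR pj s
  divR wj d

/-- Compute `t*_{ij}`, with the value `0` if its denominator vanishes. -/
def evalCrossing {n : ℕ} (w p : Fin n → ℝ) (i j : Fin n) : Timed ℝ := do
  tick
  let wi ← read w i
  let wj ← read w j
  let pi ← read p i
  let pj ← read p j
  let wipj ← mulR wi pj
  let wjpi ← mulR wj pi
  let den ← subR wipj wjpi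
  if ← eqR den 0 then return 0
  else
    let x ← mulR wjpi pi
    let y ← mulR wipj pj
    let num ← subR x y
    divR num den

/-- The precomputed data: `cross i j = t*_{ij}`, `exit i j = c_{ij} = t*_{ij} + p_j`, and for every
job `i` the lists of all jobs `j` sorted by `t*_{ij}` and by `c_{ij}`. -/
structure Tables (n : ℕ) where
  cross : Fin n → Fin n → ℝ
  exit : Fin n → Fin n → ℝ
  byCross : Fin n → List (Fin n)
  byExit : Fin n → List (Fin n)

/-- Generate and sort all `t*_{ij}` (and all `c_{ij}`). -/
def precompute {n : ℕ} (w p : Fin n → ℝ) : Timed (Tables n) := do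
  tick
  let cross ← fill fun i => fill fun j => evalCrossing w p i j
  let exit ← fill fun i => fill fun j => do
    let row ← read cross i
    let x ← read row j
    let pj ← read p j
    addR x pj
  let byCross ← fill fun i => do
    let row ← read cross i
    let all ← allJobs n
    mergeSort row n all
  let byExit ← fill fun i => do
    let row ← read exit i
    let all ← allJobs n
    mergeSort row n all
  return ⟨cross, exit, byCross, byExit⟩

/-- `t` plus the total processing time of the listed jobs. -/
def sumFrom {n : ℕ} (p : Fin n → ℝ) (t : ℝ) : List (Fin n) → Timed ℝ
  | [] => do tick; return t
  | j :: l => do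
      tick
      let pj ← read p j
      let s ← addR t pj
      sumFrom p s l

/-- A job of `a :: l` with maximum `φ(t)`, ties being broken in favour of the maximum `φ(te)`. -/
def findAlpha {n : ℕ} (w p : Fin n → ℝ) (t te : ℝ) (a : Fin n) : List (Fin n) → Timed (Fin n)
  | [] => do tick; return a
  | j :: l => do
      tick
      let x ← evalPhi w p a t
      let y ← evalPhi w p j t
      if ← ltR x y then findAlpha w p t te j l
      else if ← ltR y x then findAlpha w p t te a l
      else
        let x' ← evalPhi w p a te
        let y' ← evalPhi w p j te
        if ← ltR x' y' then findAlpha w p t te j l else findAlpha w p t te a l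

/-- The Boolean array that marks the listed jobs, starting from the marks `m`. -/
def mark {n : ℕ} (m : Fin n → Bool) : List (Fin n) → Timed (Fin n → Bool)
  | [] => do tick; return m
  | j :: l => do
      tick
      let m' ← write m j true
      mark m' l

/-- Test whether `t*_{αj}` lies in `(t, te)`. -/
def crossesIn {n : ℕ} (T : Tables n) (α : Fin n) (t te : ℝ) (j : Fin n) : Timed Bool := do
  tick
  let row ← read T.cross α
  let x ← read row j
  let b₁ ← ltR t x
  let b₂ ← ltR x te
  return b₁ && b₂

/-- Test whether `c_{αj}` is an interior point of `C_J^α`: `t*_{αj} ∈ (t, te)` and `c_{αj} < te`. -/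
def isBreak {n : ℕ} (T : Tables n) (α : Fin n) (t te : ℝ) (j : Fin n) : Timed Bool := do
  tick
  let b ← crossesIn T α t te j
  let row ← read T.exit α
  let c ← read row j
  let b' ← ltR c te
  return b && b'

/-- A branch: job `α` starts at time `start`, after the jobs of `left` and before those of `right`. -/
structure Branch (n : ℕ) where
  job : Fin n
  start : ℝ
  left : List (Fin n)
  right : List (Fin n)

/-- Sweep over the banned intervals `[t*_{αj}, c_{αj})`, listed by increasing left end: drop those
whose left end is at most `s`, and update the maximum `m` of the right ends of those dropped. -/
def sweep {n : ℕ} (T : Tables n) (α : Fin n) (s : ℝ) :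
    List (Fin n) → ℝ → Timed (List (Fin n) × ℝ)
  | [], m => do tick; return ([], m)
  | j :: l, m => do
      tick
      let row ← read T.cross α
      let x ← read row j
      if ← leR x s then
        let row' ← read T.exit α
        let c ← read row' j
        if ← ltR m c then sweep T α s l c else sweep T α s l m
      else return (j :: l, m)

/-- The loop over the points `c_q` of `C_J^α`. Arguments: the jobs whose `c_{αj}` are still to come, by
increasing `c_{αj}`; the current point `c_q`; the start time `s` of `α` after the jobs of `left`; the
lists `left`, `right`; the state of the sweep over `B_α`, in which `s ∈ B_α` iff `s < m`. -/
def scan {n : ℕ} (p : Fin n → ℝ) (T : Tables n) (α : Fin n) (te : ℝ) :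
    List (Fin n) → ℝ → ℝ → List (Fin n) → List (Fin n) → List (Fin n) → ℝ →
      Timed (List (Branch n))
  | [], c, s, left, right, bans, m => do
      tick
      let r ← sweep T α s bans m
      let b₁ ← leR c s
      let b₂ ← ltR s te
      let b₃ ← ltR s r.2
      if b₁ && b₂ && !b₃ then return [⟨α, s, left, right⟩] else return []
  | j :: l, c, s, left, right, bans, m => do
      tick
      let r ← sweep T α s bans m
      let row ← read T.exit α
      let c' ← read row j
      let b₁ ← leR c s
      let b₂ ← ltR s c'
      let b₃ ← ltR s r.2
      let pj ← read p j
      let s' ← addR s pj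
      let rest ← scan p T α te l c' s' (j :: left) right.tail r.1 r.2
      if b₁ && b₂ && !b₃ then return ⟨α, s, left, right⟩ :: rest else return rest

/-- All possible start times of job `α`, with the corresponding `J_l` and `J_r`, for the job set
`a :: l` started at time `t`. -/
def findStarts {n : ℕ} (w p : Fin n → ℝ) (T : Tables n) (a : Fin n) (l : List (Fin n)) (t : ℝ) :
    Timed (List (Branch n)) := do
  tick
  let te ← sumFrom p t (a :: l)
  let α ← findAlpha w p t te a l
  let m₀ ← fill fun _ => (pure false : Timed Bool)
  let m ← mark m₀ (a :: l)
  let m ← write m α false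
  let rowExit ← read T.byExit α
  let breaks ← select (fun j => do
    let b ← read m j
    let b' ← isBreak T α t te j
    return b && b') rowExit
  let rowCross ← read T.byCross α
  let bans ← select (fun j => do
    let b ← read m j
    let b' ← crossesIn T α t te j
    return b && b') rowCross
  let others ← select (fun j => do
    let b ← eqIdx j α
    let b' ← isBreak T α t te j
    return !b && !b') (a :: l)
  let right ← append breaks others
  scan p T α te breaks t t [] right bans t

/-- The recursive procedure `FastSchedule` on the job set `J` and start time `t`, with the precomputed tables:
returns the optimal `∑ w_j / C_j` and a schedule. The first argument bounds the recursion depth; the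
number of jobs is always enough. -/
def fastSchedule {n : ℕ} (w p : Fin n → ℝ) (T : Tables n) :
    ℕ → List (Fin n) → ℝ → Timed (ℝ × List (Fin n))
  | _, [], _ => do tick; return (0, [])
  | 0, _ :: _, _ => do tick; return (0, [])
  | _ + 1, [j], t => do
      tick
      let wj ← read w j
      let pj ← read p j
      let c ← addR pj t
      let v ← divR wj c
      return (v, [j])
  | d + 1, a :: b :: l, t => do
      tick
      let brs ← findStarts w p T a (b :: l) t
      brs.foldlM (fun (best : ℝ × List (Fin n)) (br : Branch n) => do
        tick
        let wα ← read w br.job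
        let pα ← read p br.job
        let c ← addR pα br.start
        let optL ← fastSchedule w p T d br.left t
        let optR ← fastSchedule w p T d br.right c
        let v₁ ← addR optL.1 optR.1
        let v₂ ← divR wα c
        let v ← addR v₁ v₂
        if ← ltR best.1 v then
          let seq ← append optL.2 (br.job :: optR.2)
          return (v, seq)
        else return best) (0, [])

/-- The whole computation: precomputation, then `FastSchedule` on all jobs from time `0`. -/
def solve {n : ℕ} (w p : Fin n → ℝ) : Timed (ℝ × List (Fin n)) := do
  tick
  let T ← precompute w p
  let all ← allJobs n
  fastSchedule w p T n all 0

/-- The complete schedules on a branch: the jobs of `left`, then `job` at time `start`, then the jobs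
of `right` are processed consecutively. -/
def Branch.schedules {n : ℕ} (p : Fin n → ℝ) (b : Branch n) : Set (List (Fin n)) :=
  {S | startTime p 0 S b.job = b.start ∧ ∃ A L R Z : List (Fin n),
    L.Perm b.left ∧ R.Perm b.right ∧ S = A ++ L ++ b.job :: R ++ Z}

/-- `Explored w p J t Q`: in the run of `FastSchedule` on all jobs from time `0` there is a recursive
call on `(J, t)`, and `Q` is the set of complete schedules that agree with all branches taken on the
way to that call. -/
inductive Explored {n : ℕ} (w p : Fin n → ℝ) :
    List (Fin n) → ℝ → Set (List (Fin n)) → Prop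
  | root : Explored w p (List.finRange n) 0 {S | IsSchedule S}
  | left {a b : Fin n} {l : List (Fin n)} {t : ℝ} {Q : Set (List (Fin n))} {br : Branch n}
      (h : Explored w p (a :: b :: l) t Q)
      (hbr : br ∈ (findStarts w p (precompute w p).val a (b :: l) t).val) :
      Explored w p br.left t (Q ∩ br.schedules p)
  | right {a b : Fin n} {l : List (Fin n)} {t : ℝ} {Q : Set (List (Fin n))} {br : Branch n}
      (h : Explored w p (a :: b :: l) t Q)
      (hbr : br ∈ (findStarts w p (precompute w p).val a (b :: l) t).val) :
      Explored w p br.right (p br.job + br.start) (Q ∩ br.schedules p)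

end

end Refueling

namespace Refueling

noncomputable section

/-! The order of φ_i and φ_j at time t is decided by the sign of an affine function of t
(`phi_le_iff_linear`), so distinct φ cross at most once. The exchange theorem `exists_improvement`
makes this local comparison global: if φ_i ≥ φ_j both at the start of j and at p_j before the start
of i, an order j, B, i with B nonempty can be improved, unless i and j are identical. No single
competing order need always win; rather, a nonnegative combination of the gains of two competitors
is positive, so one of them wins.

Correctness: the chosen job α has maximal φ at t, and the tie-break at t_e ensures that every other
job either never exceeds α on [t, t_e] or overtakes it strictly inside, at t*_{αj}. The exchange
theorem therefore yields a best order in which only overtaking jobs precede α, each such j satisfies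
t*_{αj} + p_j ≤ t_α, and each overtaking job after α has t_α < t*_{αj} (`Conforming`). Such a split
is determined by t_α, and `mem_findStarts` and `exists_mem_findStarts` show that the scan lists
exactly the splits of this kind. Once a branch is fixed its two sides are independent, and induction
gives `fastSchedule_isBest`.

Potential schedules: `leaves` collects the orders obtained by choosing one branch in every call.
Each is potential, because the invariant `Consistent` survives joining the two sides through α: a
job before α beats α, which beats a job after it, at a common moment (`consistent_append_cons`).
Different branches give α different start times, so the leaves are distinct and number at most K. No
call is a dead end, since some branch contains a best order; hence every branch extends to a
complete leaf, which is the third claim.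

Running time: the number of leaves of a branch is the product of the numbers for its sides, both at
least 1. The cost of a call on m jobs is thus O(n m) times its number of leaves, which gives O(n² K)
at the root, besides the sorting (`time_fastSchedule_le`, `time_precompute_le`). -/

/-- The value `∑ w_j / C_j` of a list of jobs processed from time `t`. -/
def value {n : ℕ} (w p : Fin n → ℝ) : ℝ → List (Fin n) → ℝ
  | _, [] => 0
  | t, j :: S => w j / (p j + t) + value w p (p j + t) S

/-! ### Exchange arguments and the structure of best orders -/

section

variable {n : ℕ} {w p : Fin n → ℝ}

lemma value_append (t : ℝ) (A B : List (Fin n)) :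
    value w p t (A ++ B) = value w p t A + value w p (t + (A.map p).sum) B := by
  induction A generalizing t with
  | nil => simp [value]
  | cons a A ih =>
    simp only [List.cons_append, value, ih, List.map_cons, List.sum_cons]
    rw [show p a + t + (A.map p).sum = t + (p a + (A.map p).sum) by ring]
    ring

lemma value_nonneg (hw : ∀ j, 0 < w j) (hp : ∀ j, 0 < p j) {t : ℝ} (ht : 0 ≤ t) (S : List (Fin n)) :
    0 ≤ value w p t S := by
  induction S generalizing t with
  | nil => simp [value]
  | cons a S ih =>
    have h1 := hw a
    have h2 := hp a
    have := ih (t := p a + t) (by linarith)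
    simp only [value]
    positivity

lemma sum_nonneg_of_pos (hp : ∀ j, 0 < p j) (S : List (Fin n)) : 0 ≤ (S.map p).sum :=
  List.sum_nonneg (by simp only [List.mem_map]; rintro _ ⟨j, -, rfl⟩; exact (hp j).le)

lemma sum_pos_of_ne_nil (hp : ∀ j, 0 < p j) {S : List (Fin n)} (h : S ≠ []) :
    0 < (S.map p).sum := by
  obtain ⟨j, S, rfl⟩ := List.exists_cons_of_ne_nil h
  have := sum_nonneg_of_pos hp S
  have := hp j
  simp; linarith

lemma phi_le_iff (hp : ∀ j, 0 < p j) {i j : Fin n} {t : ℝ} (ht : 0 ≤ t) :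
    phi w p j t ≤ phi w p i t ↔ w j * (p i * (p i + t)) ≤ w i * (p j * (p j + t)) := by
  have hi := hp i
  have hj := hp j
  unfold phi
  rw [div_le_div_iff₀ (by positivity) (by positivity)]

lemma phi_lt_iff (hp : ∀ j, 0 < p j) {i j : Fin n} {t : ℝ} (ht : 0 ≤ t) :
    phi w p j t < phi w p i t ↔ w j * (p i * (p i + t)) < w i * (p j * (p j + t)) := by
  rw [← not_le, phi_le_iff hp ht, not_le]

/-- Shifting a block that ends by time `b`, where `p_i < p_j`. -/
lemma block_shift_of_lt (hw : ∀ j, 0 < w j) (hp : ∀ j, 0 < p j) {pi pj b : ℝ} (hpi : 0 < pi)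
    (hij : pi < pj) (B : List (Fin n)) {x : ℝ} (hx : 0 ≤ x) (hb : x + (B.map p).sum ≤ b) :
    0 ≤ (pj - pi) * (pi + pj + b) * (value w p (pj + (pi + x)) B - value w p (pj + x) B) +
      pi * (b + pi) * (value w p (pi + x) B - value w p (pj + x) B) := by
  induction B generalizing x with
  | nil => simp [value]
  | cons k B ih =>
    have hk := hp k
    have hwk := hw k
    have hs := sum_nonneg_of_pos hp B
    simp only [List.map_cons, List.sum_cons] at hb
    have hpj : 0 < pj := by linarith
    have h := ih (x := p k + x) (by positivity) (by linarith)
    simp only [value]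
    rw [show pj + (pi + (p k + x)) = p k + (pj + (pi + x)) by ring,
      show pj + (p k + x) = p k + (pj + x) by ring,
      show pi + (p k + x) = p k + (pi + x) by ring] at h
    -- The weights balance gain and loss exactly for a block job completing at `b` when neither
    -- exchanged job precedes it; a job completing earlier gains more than it loses.
    have key : (pj - pi) * (pi + pj + b) * (w k / (p k + (pj + (pi + x))) - w k / (p k + (pj + x))) +
        pi * (b + pi) * (w k / (p k + (pi + x)) - w k / (p k + (pj + x))) =
        w k * pi * (pj - pi) * pj * (b - (p k + x)) /
          ((p k + (pj + x)) * (p k + (pi + x)) * (p k + (pj + (pi + x)))) := by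
      have h1 : p k + (pj + (pi + x)) ≠ 0 := by positivity
      have h2 : p k + (pj + x) ≠ 0 := by positivity
      have h3 : p k + (pi + x) ≠ 0 := by positivity
      field_simp
      ring
    have h4 : 0 ≤ w k * pi * (pj - pi) * pj * (b - (p k + x)) /
          ((p k + (pj + x)) * (p k + (pi + x)) * (p k + (pj + (pi + x)))) := by
      have : 0 < pj - pi := by linarith
      have : 0 ≤ b - (p k + x) := by linarith
      positivity
    linarith

/-- Shifting a block that ends by time `b`, where `p_j ≤ p_i`. -/
lemma block_shift_of_le (hw : ∀ j, 0 < w j) (hp : ∀ j, 0 < p j) {pi pj b : ℝ} (hpj : 0 < pj)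
    (hij : pj ≤ pi) (B : List (Fin n)) {x : ℝ} (hx : 0 ≤ x) (hb : x + (B.map p).sum ≤ b) :
    0 ≤ (pi - pj) * b * (value w p x B - value w p (pj + x) B) +
      pj * (b + pi) * (value w p (pi + x) B - value w p (pj + x) B) := by
  induction B generalizing x with
  | nil => simp [value]
  | cons k B ih =>
    have hk := hp k
    have hwk := hw k
    have hpi : 0 < pi := by linarith
    have hs := sum_nonneg_of_pos hp B
    simp only [List.map_cons, List.sum_cons] at hb
    have h := ih (x := p k + x) (by positivity) (by linarith)
    simp only [value]
    rw [show pj + (p k + x) = p k + (pj + x) by ring,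
      show pi + (p k + x) = p k + (pi + x) by ring] at h
    -- Again the weights are those for which a job completing at `b` breaks even; here the block is
    -- advanced by `pj` in one order and delayed by `pi - pj` in the other.
    have key : (pi - pj) * b * (w k / (p k + x) - w k / (p k + (pj + x))) +
        pj * (b + pi) * (w k / (p k + (pi + x)) - w k / (p k + (pj + x))) =
        w k * pj * (pi - pj) * pi * (b - (p k + x)) /
          ((p k + (pj + x)) * (p k + (pi + x)) * (p k + x)) := by
      have h1 : p k + x ≠ 0 := by positivity
      have h2 : p k + (pj + x) ≠ 0 := by positivity
      have h3 : p k + (pi + x) ≠ 0 := by positivity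
      field_simp
      ring
    have h4 : 0 ≤ w k * pj * (pi - pj) * pi * (b - (p k + x)) /
          ((p k + (pj + x)) * (p k + (pi + x)) * (p k + x)) := by
      have : 0 ≤ pi - pj := by linarith
      have : 0 ≤ b - (p k + x) := by linarith
      positivity
    linarith

/-- With the weights of `block_shift_of_lt`, the contributions of the two exchanged jobs split into
a multiple of the φ-comparison at `b` and a positive remainder. Only the comparison at the end of
the block is needed here. -/
lemma exchange_gain_of_lt {wi wj pi pj a b : ℝ} (hwj : 0 < wj) (hpi : 0 < pi)
    (ha : 0 ≤ a) (hab : a < b) (hij : pi < pj)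
    (hb : wj * (pi * (pi + b)) ≤ wi * (pj * (pj + b))) :
    0 < (pj - pi) * (pi + pj + b) *
        (wi / (pi + a) + wj / (pj + (pi + a)) - wj / (pj + a) - wi / (pi + (pj + b))) +
      pi * (b + pi) *
        (wi / (pi + a) + wj / (pj + (pi + b)) - wj / (pj + a) - wi / (pi + (pj + b))) := by
  have hpj : 0 < pj := by linarith
  have hb0 : 0 < b := by linarith
  have h1 : 0 < pi + a := by positivity
  have h2 : 0 < pj + a := by positivity
  have h3 : 0 < pj + (pi + a) := by positivity
  have h4 : 0 < pi + (pj + b) := by positivity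
  have h5 : pj + (pi + b) = pi + (pj + b) := by ring
  rw [h5]
  have e : (pj - pi) * (pi + pj + b) *
        (wi / (pi + a) + wj / (pj + (pi + a)) - wj / (pj + a) - wi / (pi + (pj + b))) +
      pi * (b + pi) *
        (wi / (pi + a) + wj / (pi + (pj + b)) - wj / (pj + a) - wi / (pi + (pj + b))) =
      (wi * (pj * (pj + b)) - wj * (pi * (pi + b))) * ((b - a + pj) / ((pi + a) * (pi + (pj + b))))
      + wj * pi * (pj - pi) * (b - a) * pj / ((pj + a) * (pi + a) * (pj + (pi + a))) := by
    field_simp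
    ring
  rw [e]
  have h6 : 0 ≤ wi * (pj * (pj + b)) - wj * (pi * (pi + b)) := by linarith
  have h7 : 0 < pj - pi := by linarith
  have h8 : 0 < b - a := by linarith
  positivity

/-- The counterpart for the weights of `block_shift_of_le`, resting on the φ-comparison at `a` only.
The remainder vanishes when `pi = pj`; strictness then comes from the difference of the weights,
hence `hne`. -/
lemma exchange_gain_of_le {wi wj pi pj a b : ℝ} (hwj : 0 < wj) (hpj : 0 < pj)
    (ha : 0 ≤ a) (hab : a < b) (hij : pj ≤ pi)
    (hb : wj * (pi * (pi + a)) ≤ wi * (pj * (pj + a))) (hne : ¬ (wi = wj ∧ pi = pj)) :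
    0 < (pi - pj) * b *
        (wi / (pi + b) + wj / (pj + (pi + b)) - wj / (pj + a) - wi / (pi + (pj + b))) +
      pj * (b + pi) *
        (wi / (pi + a) + wj / (pj + (pi + b)) - wj / (pj + a) - wi / (pi + (pj + b))) := by
  have hpi : 0 < pi := by linarith
  have hb0 : 0 < b := by linarith
  have h1 : 0 < pi + a := by positivity
  have h2 : 0 < pj + a := by positivity
  have h3 : 0 < pi + b := by positivity
  have h4 : 0 < pi + (pj + b) := by positivity
  have h5 : pj + (pi + b) = pi + (pj + b) := by ring
  rw [h5]
  have e : (pi - pj) * b *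
        (wi / (pi + b) + wj / (pi + (pj + b)) - wj / (pj + a) - wi / (pi + (pj + b))) +
      pj * (b + pi) *
        (wi / (pi + a) + wj / (pi + (pj + b)) - wj / (pj + a) - wi / (pi + (pj + b))) =
      (wi * (pj * (pj + a)) - wj * (pi * (pi + a))) *
        (((pi - pj) * b / (pi + b) + (b + pi) * (b - a + pj) / (pi + a)) /
          ((pj + a) * (pi + (pj + b))))
      + wj * pi * (pi - pj) * pi * (b - a) / ((pj + a) * (pi + (pj + b)) * (pi + b)) := by
    field_simp
    ring
  rw [e]
  have h6 : 0 ≤ wi * (pj * (pj + a)) - wj * (pi * (pi + a)) := by linarith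
  have h7 : 0 ≤ pi - pj := by linarith
  have h8 : 0 < b - a := by linarith
  rcases eq_or_lt_of_le hij with h | h
  · subst h
    have h9 : wj < wi := by
      refine lt_of_le_of_ne ?_ fun h => hne ⟨h.symm, rfl⟩
      exact le_of_mul_le_mul_right hb (by positivity)
    have : 0 < wi * (pj * (pj + a)) - wj * (pj * (pj + a)) := by
      rw [← sub_mul]
      exact mul_pos (by linarith) (by positivity)
    positivity
  · have h7 : 0 < pi - pj := by linarith
    positivity

/-- Local precedence implies global precedence: if `φ_i ≥ φ_j` at both ends, a schedule that places
`j`, a nonempty block `B`, and then `i` can be improved strictly. -/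
theorem exists_improvement (hw : ∀ j, 0 < w j) (hp : ∀ j, 0 < p j) {i j : Fin n} {a : ℝ}
    (ha : 0 ≤ a) {B : List (Fin n)} (hB : B ≠ [])
    (h1 : phi w p j a ≤ phi w p i a)
    (h2 : phi w p j (a + (B.map p).sum) ≤ phi w p i (a + (B.map p).sum))
    (hne : ¬ (w i = w j ∧ p i = p j)) :
    ∃ S : List (Fin n), S.Perm (j :: B ++ [i]) ∧ value w p a (j :: B ++ [i]) < value w p a S := by
  have hpos := sum_pos_of_ne_nil hp hB
  rw [phi_le_iff hp ha] at h1
  rw [phi_le_iff hp (by positivity)] at h2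
  have v0 : value w p a (j :: B ++ [i]) = w j / (p j + a) + value w p (p j + a) B +
      w i / (p i + (p j + (a + (B.map p).sum))) := by
    simp only [value, List.cons_append, value_append]
    rw [show p j + a + (B.map p).sum = p j + (a + (B.map p).sum) by ring]
    ring
  have v3 : value w p a (i :: B ++ [j]) = w i / (p i + a) + value w p (p i + a) B +
      w j / (p j + (p i + (a + (B.map p).sum))) := by
    simp only [value, List.cons_append, value_append]
    rw [show p i + a + (B.map p).sum = p i + (a + (B.map p).sum) by ring]
    ring
  have v2 : value w p a (i :: j :: B) = w i / (p i + a) + w j / (p j + (p i + a)) +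
      value w p (p j + (p i + a)) B := by
    simp only [value]
    ring
  have v1 : value w p a (B ++ [i, j]) = value w p a B + w i / (p i + (a + (B.map p).sum)) +
      w j / (p j + (p i + (a + (B.map p).sum))) := by
    simp only [value, value_append]
    ring
  -- If no order beat j, B, i, any nonnegative combination of the gains of two competitors would be
  -- nonpositive; the block lemma and the exchange lemma together say it is positive.
  by_contra! hcon
  have c3 := hcon (i :: B ++ [j]) (by
    simp only [List.cons_append]
    exact ((List.perm_append_singleton j B).cons i).trans ((List.Perm.swap j i B).trans
      ((List.perm_append_singleton i B).symm.cons j)))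
  have hpi := hp i
  have hpj := hp j
  rw [v0, v3] at c3
  -- One competitor is always i, B, j. It advances the block if p_i < p_j and is then paired with i,
  -- j, B; otherwise it does not advance the block and is paired with B, i, j.
  rcases lt_or_ge (p i) (p j) with hij | hij
  · have c2 := hcon (i :: j :: B) ((List.Perm.swap j i B).trans
      ((List.perm_append_singleton i B).symm.cons j))
    rw [v0, v2] at c2
    have g1 := block_shift_of_lt hw hp hpi hij B ha le_rfl
    have g2 := exchange_gain_of_lt (hw j) hpi ha (by linarith) hij h2
    have s1 : 0 ≤ (p j - p i) * (p i + p j + (a + (B.map p).sum)) :=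
      mul_nonneg (by linarith) (by positivity)
    have s2 : 0 ≤ p i * ((a + (B.map p).sum) + p i) := by positivity
    have m1 := mul_le_mul_of_nonneg_left c2 s1
    have m2 := mul_le_mul_of_nonneg_left c3 s2
    linarith
  · have c1 := hcon (B ++ [i, j]) (by
      rw [show B ++ [i, j] = (B ++ [i]) ++ [j] by simp]
      exact (List.perm_append_singleton j _))
    rw [v0, v1] at c1
    have g1 := block_shift_of_le hw hp hpj hij B ha le_rfl
    have g2 := exchange_gain_of_le (b := a + (B.map p).sum) (hw j) hpj ha (by linarith) hij h1 hne
    have s1 : 0 ≤ (p i - p j) * (a + (B.map p).sum) :=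
      mul_nonneg (by linarith) (by positivity)
    have s2 : 0 ≤ p j * ((a + (B.map p).sum) + p i) := by positivity
    have m1 := mul_le_mul_of_nonneg_left c1 s1
    have m2 := mul_le_mul_of_nonneg_left c3 s2
    linarith

lemma value_swap (hp : ∀ j, 0 < p j) {i j : Fin n} {a : ℝ} (ha : 0 ≤ a) (S : List (Fin n)) :
    value w p a (i :: j :: S) - value w p a (j :: i :: S) =
      (w i * (p j * (p j + a)) - w j * (p i * (p i + a))) /
        ((p i + a) * (p j + a) * (p i + p j + a)) := by
  have hpi := hp i
  have hpj := hp j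
  simp only [value]
  rw [show p i + (p j + a) = p i + p j + a by ring, show p j + (p i + a) = p i + p j + a by ring]
  have h1 : p i + a ≠ 0 := by positivity
  have h2 : p j + a ≠ 0 := by positivity
  have h3 : p i + p j + a ≠ 0 := by positivity
  field_simp
  ring

lemma value_congr {S T : List (Fin n)} (hS : S.map w = T.map w) (hT : S.map p = T.map p) (t : ℝ) :
    value w p t S = value w p t T := by
  induction S generalizing T t with
  | nil => cases T <;> simp_all
  | cons a S ih =>
    cases T with
    | nil => simp at hS
    | cons b T =>
      simp only [List.map_cons, List.cons.injEq] at hS hT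
      simp only [value, hS.1, hT.1, ih hS.2 hT.2]

/-- `S` has the maximum value among all orders of the jobs of `J` from time `t`. -/
def IsBest (w p : Fin n → ℝ) (J : List (Fin n)) (t : ℝ) (S : List (Fin n)) : Prop :=
  S.Perm J ∧ ∀ S' : List (Fin n), S'.Perm J → value w p t S' ≤ value w p t S

lemma exists_isBest (w p : Fin n → ℝ) (J : List (Fin n)) (t : ℝ) : ∃ S, IsBest w p J t S := by
  obtain ⟨S, hS, h⟩ := J.permutations.toFinset.exists_max_image (value w p t)
    ⟨J, by simp⟩
  exact ⟨S, by simpa using hS, fun T hT => h T (by simpa using hT)⟩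

/-- In a best schedule the dominance relation holds up to ties between neighbours. -/
lemma IsBest.eq_nil_of_dominated (hw : ∀ j, 0 < w j) (hp : ∀ j, 0 < p j) {J : List (Fin n)} {t : ℝ}
    (ht : 0 ≤ t) {A B Z : List (Fin n)} {i j : Fin n} (h : IsBest w p J t (A ++ j :: B ++ i :: Z))
    (h1 : phi w p j (t + (A.map p).sum) ≤ phi w p i (t + (A.map p).sum))
    (h2 : phi w p j (t + (A.map p).sum + (B.map p).sum) ≤
      phi w p i (t + (A.map p).sum + (B.map p).sum))
    (hne : ¬ (w i = w j ∧ p i = p j)) :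
    B = [] ∧ phi w p j (t + (A.map p).sum) = phi w p i (t + (A.map p).sum) ∧
      IsBest w p J t (A ++ i :: j :: Z) := by
  have hA := sum_nonneg_of_pos hp A
  have ha : 0 ≤ t + (A.map p).sum := by positivity
  -- The permuted segment has the same length in time, so an improvement of j, B, i leaves the value
  -- of the tail unchanged and improves the whole order.
  have hB : B = [] := by
    by_contra hB
    obtain ⟨S, hS, hlt⟩ := exists_improvement hw hp ha hB h1 h2 hne
    have e : A ++ j :: B ++ i :: Z = A ++ (j :: B ++ [i]) ++ Z := by simp
    have := h.2 (A ++ S ++ Z) (by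
      refine List.Perm.trans ?_ h.1
      rw [e]
      exact (hS.append_left A).append_right Z)
    rw [e] at this
    simp only [value_append, List.map_append, List.sum_append, (hS.map p).sum_eq] at this hlt
    linarith
  subst hB
  have hperm : (A ++ i :: j :: Z).Perm (A ++ j :: [] ++ i :: Z) := by
    simpa using (List.Perm.swap j i Z).append_left A
  have hle := h.2 _ (hperm.trans h.1)
  have hsw := value_swap (w := w) hp (i := i) (j := j) ha Z
  have hpi := hp i
  have hpj := hp j
  have hle' : value w p (t + (A.map p).sum) (i :: j :: Z) ≤
      value w p (t + (A.map p).sum) (j :: i :: Z) := by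
    simp only [List.append_assoc, List.cons_append, List.nil_append, value_append] at hle
    linarith
  -- For neighbours, optimality yields the inequality opposite to `h1`; so φ ties at the start of j,
  -- and swapping costs nothing.
  have hnum : w i * (p j * (p j + (t + (A.map p).sum))) ≤
      w j * (p i * (p i + (t + (A.map p).sum))) := by
    by_contra hcon
    have : 0 < value w p (t + (A.map p).sum) (i :: j :: Z) -
        value w p (t + (A.map p).sum) (j :: i :: Z) := by
      rw [hsw]
      exact div_pos (by linarith) (by positivity)
    linarith
  have hge := (phi_le_iff hp (i := j) (j := i) ha).2 hnum
  have heq := le_antisymm h1 hge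
  refine ⟨rfl, heq, hperm.trans h.1, fun S' hS' => (h.2 S' hS').trans ?_⟩
  rw [phi_le_iff hp ha] at h1
  have : w i * (p j * (p j + (t + (A.map p).sum))) -
      w j * (p i * (p i + (t + (A.map p).sum))) = 0 := by linarith
  rw [this, zero_div] at hsw
  simp only [List.append_assoc, List.cons_append, List.nil_append, value_append]
  linarith

/-- The value depends only on the sequences of weights and processing times. This covers the case
that the exchange theorem must exclude. -/
lemma IsBest.swap_identical {J : List (Fin n)} {t : ℝ} {A B Z : List (Fin n)} {i j : Fin n}
    (h : IsBest w p J t (A ++ j :: B ++ i :: Z)) (hw : w i = w j) (hp : p i = p j) :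
    IsBest w p J t (A ++ i :: B ++ j :: Z) := by
  refine ⟨List.Perm.trans ?_ h.1, fun S' hS' => (h.2 S' hS').trans ?_⟩
  · simp only [List.append_assoc, List.cons_append]
    refine List.Perm.append_left A ?_
    exact (List.perm_middle.cons i).trans ((List.Perm.swap j i _).trans
      (List.perm_middle.symm.cons j))
  · exact (value_congr (by simp [hw]) (by simp [hp]) t).le

end

/-! ### Results computed by the elementary programs -/

section Values

variable {β γ : Type}

@[simp] lemma val_bind (x : Timed β) (f : β → Timed γ) : (x >>= f).val = (f x.val).val := rfl
@[simp] lemma time_bind (x : Timed β) (f : β → Timed γ) :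
    (x >>= f).time = x.time + (f x.val).time := rfl
@[simp] lemma val_pure (a : β) : (pure a : Timed β).val = a := rfl
@[simp] lemma time_pure (a : β) : (pure a : Timed β).time = 0 := rfl
@[simp] lemma val_ite (c : Prop) [Decidable c] (x y : Timed β) :
    (if c then x else y).val = if c then x.val else y.val := apply_ite _ _ _ _
@[simp] lemma time_ite (c : Prop) [Decidable c] (x y : Timed β) :
    (if c then x else y).time = if c then x.time else y.time := apply_ite _ _ _ _
@[simp] lemma time_tick : tick.time = 1 := rfl
@[simp] lemma val_addR (a b : ℝ) : (addR a b).val = a + b := (rfl)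
@[simp] lemma val_subR (a b : ℝ) : (subR a b).val = a - b := (rfl)
@[simp] lemma val_mulR (a b : ℝ) : (mulR a b).val = a * b := (rfl)
@[simp] lemma val_divR (a b : ℝ) : (divR a b).val = a / b := (rfl)
@[simp] lemma val_ltR (a b : ℝ) : (ltR a b).val = decide (a < b) := (rfl)
@[simp] lemma val_leR (a b : ℝ) : (leR a b).val = decide (a ≤ b) := (rfl)
@[simp] lemma val_eqR (a b : ℝ) : (eqR a b).val = decide (a = b) := (rfl)
@[simp] lemma time_addR (a b : ℝ) : (addR a b).time = 1 := rfl
@[simp] lemma time_subR (a b : ℝ) : (subR a b).time = 1 := rfl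
@[simp] lemma time_mulR (a b : ℝ) : (mulR a b).time = 1 := rfl
@[simp] lemma time_divR (a b : ℝ) : (divR a b).time = 1 := rfl
@[simp] lemma time_ltR (a b : ℝ) : (ltR a b).time = 1 := rfl
@[simp] lemma time_leR (a b : ℝ) : (leR a b).time = 1 := rfl
@[simp] lemma time_eqR (a b : ℝ) : (eqR a b).time = 1 := rfl

variable {n : ℕ}

@[simp] lemma val_eqIdx (i j : Fin n) : (eqIdx i j).val = decide (i = j) := (rfl)
@[simp] lemma time_eqIdx (i j : Fin n) : (eqIdx i j).time = 1 := rfl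
@[simp] lemma val_read (a : Fin n → β) (i : Fin n) : (read a i).val = a i := (rfl)
@[simp] lemma time_read (a : Fin n → β) (i : Fin n) : (read a i).time = 1 := rfl
@[simp] lemma val_write (a : Fin n → β) (i : Fin n) (b : β) :
    (write a i b).val = Function.update a i b := rfl
@[simp] lemma time_write (a : Fin n → β) (i : Fin n) (b : β) : (write a i b).time = 1 := rfl
@[simp] lemma val_fill (f : Fin n → Timed β) : (fill f).val = fun i => (f i).val := (rfl)
@[simp] lemma time_fill (f : Fin n → Timed β) :
    (fill f).time = 1 + ∑ i, ((f i).time + 1) := rfl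
@[simp] lemma val_allJobs : (allJobs n).val = List.finRange n := (rfl)
@[simp] lemma time_allJobs : (allJobs n).time = n + 1 := rfl

@[simp] lemma val_select (test : β → Timed Bool) (l : List β) :
    (select test l).val = l.filter fun a => (test a).val := by
  induction l with
  | nil => rfl
  | cons a l ih =>
    simp only [select, val_bind, val_ite, val_pure, ih, List.filter_cons]

@[simp] lemma val_append (k l : List β) : (append k l).val = k ++ l := by
  induction k with
  | nil => rfl
  | cons a k ih => simp [append, ih]

lemma split_perm (l : List β) : ((split l).val.1 ++ (split l).val.2).Perm l := by
  induction l with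
  | nil => exact List.Perm.refl _
  | cons a l ih =>
    simp only [split, val_bind, val_pure, List.cons_append]
    exact (List.perm_append_comm.trans ih).cons a

/-- The two halves trade places at every step, so the first is the longer one when the length is
odd. -/
lemma length_split (l : List β) :
    (split l).val.1.length = (l.length + 1) / 2 ∧ (split l).val.2.length = l.length / 2 := by
  induction l with
  | nil => simp [split]
  | cons a l ih =>
    simp only [split, val_bind, val_pure, List.length_cons, ih.1, ih.2]
    exact ⟨(Nat.add_div_right _ two_pos).symm, trivial⟩

lemma merge_perm (key : Fin n → ℝ) (k l : List (Fin n)) :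
    (merge key k l).val.Perm (k ++ l) := by
  induction k, l using merge.induct with
  | case1 l => simp [merge]
  | case2 a k => simp [merge]
  | case3 a k b l h1 h2 =>
    simp only [merge, val_bind, val_ite, val_pure]
    split_ifs
    · exact h1.cons a
    · exact (h2.cons b).trans List.perm_middle.symm

lemma merge_sorted (key : Fin n → ℝ) (k l : List (Fin n))
    (hk : k.Pairwise fun x y => key x ≤ key y) (hl : l.Pairwise fun x y => key x ≤ key y) :
    (merge key k l).val.Pairwise fun x y => key x ≤ key y := by
  induction k, l using merge.induct with
  | case1 l => simpa [merge] using hl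
  | case2 a k => simpa [merge] using hk
  | case3 a k b l h1 h2 =>
    simp only [merge, val_bind, val_ite, val_pure, val_read, val_leR, decide_eq_true_eq]
    have hk' := List.pairwise_cons.1 hk
    have hl' := List.pairwise_cons.1 hl
    split_ifs with h
    · refine List.pairwise_cons.2 ⟨fun x hx => ?_, h1 hk'.2 hl⟩
      rw [(merge_perm key _ _).mem_iff, List.mem_append, List.mem_cons] at hx
      rcases hx with hx | rfl | hx
      · exact hk'.1 x hx
      · exact h
      · exact h.trans (hl'.1 x hx)
    · refine List.pairwise_cons.2 ⟨fun x hx => ?_, h2 hk hl'.2⟩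
      rw [(merge_perm key _ _).mem_iff, List.mem_append, List.mem_cons] at hx
      rcases hx with (rfl | hx) | hx
      · exact (not_le.1 h).le
      · exact (not_le.1 h).le.trans (hk'.1 x hx)
      · exact hl'.1 x hx

lemma mergeSort_perm (key : Fin n → ℝ) (d : ℕ) (l : List (Fin n)) :
    (mergeSort key d l).val.Perm l := by
  induction d generalizing l with
  | zero => simp [mergeSort]
  | succ d ih =>
    match l with
    | [] => simp [mergeSort]
    | [a] => simp [mergeSort]
    | a :: b :: l =>
      simp only [mergeSort, val_bind]
      exact (merge_perm key _ _).trans (((ih _).append (ih _)).trans (split_perm _))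

lemma mergeSort_sorted (key : Fin n → ℝ) (d : ℕ) (l : List (Fin n)) (hd : l.length ≤ d) :
    (mergeSort key d l).val.Pairwise fun x y => key x ≤ key y := by
  induction d generalizing l with
  | zero => simp [List.length_eq_zero_iff.1 (Nat.le_zero.1 hd), mergeSort]
  | succ d ih =>
    match l with
    | [] => simp [mergeSort]
    | [a] => simp [mergeSort]
    | a :: b :: l =>
      simp only [mergeSort, val_bind]
      have := length_split (a :: b :: l)
      simp only [List.length_cons] at this hd
      exact merge_sorted key _ _ (ih _ (by omega)) (ih _ (by omega))

@[simp] lemma val_sumFrom (p : Fin n → ℝ) (t : ℝ) (l : List (Fin n)) :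
    (sumFrom p t l).val = t + (l.map p).sum := by
  induction l generalizing t with
  | nil => simp [sumFrom]
  | cons a l ih => simp [sumFrom, ih, add_assoc]

@[simp] lemma val_mark (m : Fin n → Bool) (l : List (Fin n)) (j : Fin n) :
    (mark m l).val j = (m j || decide (j ∈ l)) := by
  induction l generalizing m with
  | nil => simp [mark]
  | cons a l ih =>
    simp only [mark, val_bind, ih, val_write, List.mem_cons]
    by_cases h : j = a <;> simp [h, Function.update]

@[simp] lemma val_evalPhi (w p : Fin n → ℝ) (j : Fin n) (t : ℝ) :
    (evalPhi w p j t).val = phi w p j t := rfl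

@[simp] lemma val_evalCrossing (w p : Fin n → ℝ) (i j : Fin n) :
    (evalCrossing w p i j).val = tstar w p i j := by
  simp only [evalCrossing, val_bind, val_ite, val_pure, val_read, val_subR, val_mulR, val_divR,
    val_eqR, decide_eq_true_eq, tstar]
  split_ifs with h
  -- The default 0 of the program agrees with real division by zero in `tstar`.
  · rw [h, div_zero]
  · ring_nf

/-- Job `i` has a larger `φ(t)` than `j`, or the same and at least as large a `φ(te)`. -/
def PhiGE (w p : Fin n → ℝ) (t te : ℝ) (i j : Fin n) : Prop :=
  phi w p j t < phi w p i t ∨ (phi w p j t = phi w p i t ∧ phi w p j te ≤ phi w p i te)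

lemma PhiGE.trans {w p : Fin n → ℝ} {t te : ℝ} {i j k : Fin n} (h : PhiGE w p t te i j)
    (h' : PhiGE w p t te j k) : PhiGE w p t te i k := by
  rcases h with h | ⟨h, h1⟩ <;> rcases h' with h' | ⟨h', h2⟩
  · exact Or.inl (h'.trans h)
  · exact Or.inl (h'.trans_lt h)
  · exact Or.inl (h'.trans_eq h)
  · exact Or.inr ⟨h'.trans h, h2.trans h1⟩

lemma findAlpha_spec (w p : Fin n → ℝ) (t te : ℝ) (a : Fin n) (l : List (Fin n)) :
    (findAlpha w p t te a l).val ∈ a :: l ∧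
      ∀ j ∈ a :: l, PhiGE w p t te (findAlpha w p t te a l).val j := by
  induction l generalizing a with
  | nil => simp [findAlpha, PhiGE]
  | cons j l ih =>
    have keepNew (h : PhiGE w p t te j a) : (findAlpha w p t te j l).val ∈ a :: j :: l ∧
        ∀ i ∈ a :: j :: l, PhiGE w p t te (findAlpha w p t te j l).val i := by
      obtain ⟨h1, h2⟩ := ih j
      refine ⟨List.mem_cons_of_mem _ h1, fun i hi => ?_⟩
      rcases List.mem_cons.1 hi with rfl | hi
      · exact (h2 j (by simp)).trans h
      · exact h2 i hi
    have keepOld (h : PhiGE w p t te a j) : (findAlpha w p t te a l).val ∈ a :: j :: l ∧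
        ∀ i ∈ a :: j :: l, PhiGE w p t te (findAlpha w p t te a l).val i := by
      obtain ⟨h1, h2⟩ := ih a
      refine ⟨?_, fun i hi => ?_⟩
      · rcases List.mem_cons.1 h1 with h1 | h1
        · rw [h1]; simp
        · simp [h1]
      · rcases List.mem_cons.1 hi with rfl | hi
        · exact h2 i (by simp)
        · rcases List.mem_cons.1 hi with rfl | hi
          · exact (h2 a (by simp)).trans h
          · exact h2 i (by simp [hi])
    simp only [findAlpha, val_bind, val_ite, val_evalPhi, val_ltR, decide_eq_true_eq]
    split_ifs with h1 h2 h3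
    · exact keepNew (Or.inl h1)
    · exact keepOld (Or.inl h2)
    · exact keepNew (Or.inr ⟨le_antisymm (not_lt.1 h2) (not_lt.1 h1), h3.le⟩)
    · exact keepOld (Or.inr ⟨le_antisymm (not_lt.1 h1) (not_lt.1 h2), not_lt.1 h3⟩)

lemma val_precompute (w p : Fin n → ℝ) :
    (precompute w p).val = ⟨tstar w p, fun i j => tstar w p i j + p j,
      fun i => (mergeSort (tstar w p i) n (List.finRange n)).val,
      fun i => (mergeSort (fun j => tstar w p i j + p j) n (List.finRange n)).val⟩ := by
  simp [precompute]

@[simp] lemma val_crossesIn (T : Tables n) (α : Fin n) (t te : ℝ) (j : Fin n) :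
    (crossesIn T α t te j).val = (decide (t < T.cross α j) && decide (T.cross α j < te)) := rfl

@[simp] lemma val_isBreak (T : Tables n) (α : Fin n) (t te : ℝ) (j : Fin n) :
    (isBreak T α t te j).val = ((decide (t < T.cross α j) && decide (T.cross α j < te)) &&
      decide (T.exit α j < te)) := rfl

/-- The state `(bans, m)` of the sweep excludes the start time `s`. -/
def Banned (T : Tables n) (α : Fin n) (bans : List (Fin n)) (m s : ℝ) : Prop :=
  s < m ∨ ∃ j ∈ bans, T.cross α j ≤ s ∧ s < T.exit α j

/-- Start times only increase during the scan. For any later s', an interval whose left end has been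
passed excludes s' exactly when s' is below its right end, so only the maximum of those right ends
must be remembered. -/
lemma sweep_spec (T : Tables n) (α : Fin n) (s : ℝ) (bans : List (Fin n)) (m : ℝ)
    (hs : bans.Pairwise fun x y => T.cross α x ≤ T.cross α y) :
    (sweep T α s bans m).val.1 <:+ bans ∧
      (∀ j ∈ (sweep T α s bans m).val.1, s < T.cross α j) ∧
      ∀ s', s ≤ s' → (Banned T α (sweep T α s bans m).val.1 (sweep T α s bans m).val.2 s' ↔
        Banned T α bans m s') := by
  induction bans generalizing m with
  | nil => simp [sweep]
  | cons j l ih =>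
    have hs' := List.pairwise_cons.1 hs
    simp only [sweep, val_bind, val_ite, val_read, val_leR, val_ltR, val_pure, decide_eq_true_eq]
    split_ifs with h1 h2
    · obtain ⟨i1, i2, i3⟩ := ih (T.exit α j) hs'.2
      refine ⟨i1.trans (List.suffix_cons _ _), i2, fun s' hs'' => (i3 s' hs'').trans ?_⟩
      simp only [Banned, List.mem_cons, exists_eq_or_imp]
      constructor
      · rintro (h | h)
        · exact Or.inr (Or.inl ⟨h1.trans hs'', h⟩)
        · exact Or.inr (Or.inr h)
      · rintro (h | h | h)
        · exact Or.inl (h.trans h2)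
        · exact Or.inl h.2
        · exact Or.inr h
    · obtain ⟨i1, i2, i3⟩ := ih m hs'.2
      refine ⟨i1.trans (List.suffix_cons _ _), i2, fun s' hs'' => (i3 s' hs'').trans ?_⟩
      simp only [Banned, List.mem_cons, exists_eq_or_imp]
      constructor
      · rintro (h | h)
        · exact Or.inl h
        · exact Or.inr (Or.inr h)
      · rintro (h | h | h)
        · exact Or.inl h
        · exact Or.inl (h.2.trans_le (not_lt.1 h2))
        · exact Or.inr h
    · refine ⟨List.suffix_refl _, fun i hi => ?_, fun _ _ => Iff.rfl⟩
      rcases List.mem_cons.1 hi with rfl | hi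
      · exact not_le.1 h1
      · exact (not_le.1 h1).trans_le (hs'.1 i hi)

/-- All intervals left after the sweep begin beyond `s`, so the remembered maximum alone decides
whether `s` is banned. -/
lemma sweep_lt_iff (T : Tables n) (α : Fin n) (s : ℝ) (bans : List (Fin n)) (m : ℝ)
    (hs : bans.Pairwise fun x y => T.cross α x ≤ T.cross α y) :
    s < (sweep T α s bans m).val.2 ↔ Banned T α bans m s := by
  obtain ⟨-, h2, h3⟩ := sweep_spec T α s bans m hs
  rw [← h3 s le_rfl]
  refine ⟨Or.inl, ?_⟩
  rintro (h | ⟨j, hj, h, -⟩)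
  · exact h
  · exact absurd (h2 j hj) (not_lt.2 h)

/-- A branch corresponds to a cut of the sorted break points: the prefix `k₁` goes before α, and the
resulting start time must lie between the two points at the cut and be unbanned. Sortedness turns
the comparison with the neighbouring points into one with all of them. -/
lemma mem_scan_iff (p : Fin n → ℝ) (hp : ∀ j, 0 < p j) (T : Tables n) (α : Fin n) (te : ℝ)
    (bs : List (Fin n)) (c s : ℝ) (left right bans : List (Fin n)) (m : ℝ) (br : Branch n)
    (hbans : bans.Pairwise fun x y => T.cross α x ≤ T.cross α y)
    (hbs : bs.Pairwise fun x y => T.exit α x ≤ T.exit α y)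
    (hte : ∀ j ∈ bs, T.exit α j < te) (hc : ∀ j ∈ bs, c ≤ T.exit α j) :
    br ∈ (scan p T α te bs c s left right bans m).val ↔
      ∃ k₁ k₂, bs = k₁ ++ k₂ ∧
        br = ⟨α, s + (k₁.map p).sum, k₁.reverse ++ left, right.drop k₁.length⟩ ∧
        c ≤ br.start ∧ (∀ j ∈ k₁, T.exit α j ≤ br.start) ∧ (∀ j ∈ k₂, br.start < T.exit α j) ∧
        br.start < te ∧ ¬ Banned T α bans m br.start := by
  induction bs generalizing c s left right bans m with
  | nil =>
    simp only [scan, val_bind, val_ite, val_pure]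
    constructor
    · split_ifs with h
      · intro hbr
        simp only [val_leR, val_ltR, Bool.and_eq_true, decide_eq_true_eq,
          Bool.not_eq_true', decide_eq_false_iff_not, sweep_lt_iff T α s bans m hbans] at h
        rw [List.mem_singleton] at hbr
        subst hbr
        exact ⟨[], [], rfl, by simp, by simpa using h.1.1, by simp, by simp, by simpa using h.1.2,
          by simpa using h.2⟩
      · simp
    · rintro ⟨k₁, k₂, h, rfl, h1, -, -, h2, h3⟩
      obtain ⟨rfl, rfl⟩ := List.append_eq_nil_iff.1 h.symm
      simp only [List.map_nil, List.sum_nil, add_zero] at h1 h2 h3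
      rw [if_pos (by simp [h1, h2, sweep_lt_iff T α s bans m hbans, h3, -not_lt])]
      simp
  | cons j bs ih =>
    obtain ⟨s1, s2, s3⟩ := sweep_spec T α s bans m hbans
    have hbs' := List.pairwise_cons.1 hbs
    have IH := ih (T.exit α j) (s + p j) (j :: left) right.tail (sweep T α s bans m).val.1
      (sweep T α s bans m).val.2 (hbans.sublist s1.sublist) hbs'.2
      (fun i hi => hte i (by simp [hi])) hbs'.1
    have hpj := hp j
    have key : br ∈ (scan p T α te bs (T.exit α j) (s + p j) (j :: left) right.tail
        (sweep T α s bans m).val.1 (sweep T α s bans m).val.2).val ↔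
      ∃ k₁ k₂, bs = k₁ ++ k₂ ∧
        br = ⟨α, s + ((j :: k₁).map p).sum, (j :: k₁).reverse ++ left,
          right.drop (j :: k₁).length⟩ ∧
        c ≤ br.start ∧ (∀ i ∈ j :: k₁, T.exit α i ≤ br.start) ∧
        (∀ i ∈ k₂, br.start < T.exit α i) ∧
        br.start < te ∧ ¬ Banned T α bans m br.start := by
      rw [IH]
      refine exists_congr fun k₁ => exists_congr fun k₂ => and_congr_right fun _ => ?_
      have hsum := sum_nonneg_of_pos hp k₁
      simp only [List.map_cons, List.sum_cons, ← add_assoc, List.reverse_cons, List.append_assoc,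
        List.cons_append, List.nil_append, List.length_cons, ← List.drop_one, List.drop_drop,
        List.mem_cons, forall_eq_or_imp]
      rw [Nat.add_comm 1]
      refine and_congr_right fun hbr => ?_
      have hst : s ≤ br.start := by rw [hbr]; simp only; linarith
      rw [s3 _ hst]
      -- The bound by the old point `c` follows from the bound by the next one, since `c ≤ T.exit α
      -- j`.
      have := hc j (by simp)
      constructor
      · rintro ⟨h1, h2, h3, h4⟩
        exact ⟨this.trans h1, ⟨h1, h2⟩, h3, h4⟩
      · rintro ⟨h1, ⟨h2, h3⟩, h4, h5⟩
        exact ⟨h2, h3, h4, h5⟩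
    have hsplit : (∃ k₁ k₂, j :: bs = k₁ ++ k₂ ∧
        br = ⟨α, s + (k₁.map p).sum, k₁.reverse ++ left, right.drop k₁.length⟩ ∧
        c ≤ br.start ∧ (∀ i ∈ k₁, T.exit α i ≤ br.start) ∧ (∀ i ∈ k₂, br.start < T.exit α i) ∧
        br.start < te ∧ ¬ Banned T α bans m br.start) ↔
        ((br = ⟨α, s, left, right⟩ ∧ c ≤ s ∧ s < T.exit α j ∧ ¬ Banned T α bans m s) ∨
          br ∈ (scan p T α te bs (T.exit α j) (s + p j) (j :: left) right.tail
            (sweep T α s bans m).val.1 (sweep T α s bans m).val.2).val) := by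
      rw [key]
      constructor
      · rintro ⟨k₁, k₂, h1, h2, h3, h4, h5, h6, h7⟩
        rcases k₁ with _ | ⟨i, k₁⟩
        · left
          simp only [List.map_nil, List.sum_nil, add_zero, List.reverse_nil, List.nil_append,
            List.length_nil, List.drop_zero] at h1 h2
          subst h1 h2
          exact ⟨rfl, h3, h5 j (by simp), h7⟩
        · right
          simp only [List.cons_append, List.cons.injEq] at h1
          obtain ⟨rfl, h1⟩ := h1
          exact ⟨k₁, k₂, h1, h2, h3, h4, h5, h6, h7⟩
      · rintro (⟨rfl, h1, h2, h3⟩ | ⟨k₁, k₂, h1, h2⟩)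
        -- Before the last point the test against `te` is automatic, because every break point lies
        -- below `te`.
        · refine ⟨[], j :: bs, rfl, by simp, h1, by simp, fun i hi => ?_,
            h2.trans (hte j (by simp)), h3⟩
          rcases List.mem_cons.1 hi with rfl | hi
          · exact h2
          · exact h2.trans_le (hbs'.1 i hi)
        · exact ⟨j :: k₁, k₂, by simp [h1], h2⟩
    rw [hsplit]
    simp only [scan, val_bind, val_ite, val_pure]
    split_ifs with h <;> simp only [val_leR, val_ltR, val_read, Bool.and_eq_true,
      decide_eq_true_eq, Bool.not_eq_true', decide_eq_false_iff_not,
      sweep_lt_iff T α s bans m hbans] at h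
    · rw [List.mem_cons]
      refine or_congr ⟨fun hb => ⟨hb, h.1.1, h.1.2, h.2⟩, fun hb => hb.1⟩ Iff.rfl
    · refine ⟨Or.inr, ?_⟩
      rintro (⟨-, h1, h2, h3⟩ | hb)
      · exact absurd ⟨⟨h1, h2⟩, h3⟩ h
      · exact hb

/-- Every further job moved to the left adds a positive processing time. Strictly increasing start
times later separate the leaves of different branches. -/
lemma scan_pairwise (p : Fin n → ℝ) (hp : ∀ j, 0 < p j) (T : Tables n) (α : Fin n) (te : ℝ)
    (bs : List (Fin n)) (c s : ℝ) (left right bans : List (Fin n)) (m : ℝ) :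
    (scan p T α te bs c s left right bans m).val.Pairwise (fun b b' => b.start < b'.start) ∧
      ∀ br ∈ (scan p T α te bs c s left right bans m).val, s ≤ br.start := by
  induction bs generalizing c s left right bans m with
  | nil =>
    simp only [scan, val_bind, val_ite, val_pure]
    split_ifs <;> simp
  | cons j bs ih =>
    have hpj := hp j
    simp only [scan, val_bind, val_ite, val_pure, val_read, val_addR]
    obtain ⟨h1, h2⟩ := ih (T.exit α j) (s + p j) (j :: left) right.tail
      (sweep T α s bans m).val.1 (sweep T α s bans m).val.2
    split_ifs
    · refine ⟨List.pairwise_cons.2 ⟨fun br hbr => ?_, h1⟩, fun br hbr => ?_⟩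
      · have := h2 br hbr
        simp only
        linarith
      · rcases List.mem_cons.1 hbr with rfl | hbr
        · exact le_rfl
        · have := h2 br hbr
          linarith
    · refine ⟨h1, fun br hbr => ?_⟩
      have := h2 br hbr
      linarith

end Values

/-! ### Branches are exactly the conforming splits -/

/-- The job that `FastSchedule` selects for the job set `a :: l` at time `t`. -/
def pivot {n : ℕ} (w p : Fin n → ℝ) (a : Fin n) (l : List (Fin n)) (t : ℝ) : Fin n :=
  (findAlpha w p t (t + ((a :: l).map p).sum) a l).val

/-- `t*_{αj}` lies strictly between `t` and `te`. -/
def Crosses {n : ℕ} (w p : Fin n → ℝ) (t te : ℝ) (α j : Fin n) : Prop :=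
  t < tstar w p α j ∧ tstar w p α j < te

/-- `L` before and `R` after `α`, started at `s`, obey the dominance rule for `α`. -/
structure Conforming {n : ℕ} (w p : Fin n → ℝ) (t te : ℝ) (α : Fin n) (s : ℝ)
    (L R : List (Fin n)) : Prop where
  left : ∀ j ∈ L, Crosses w p t te α j ∧ tstar w p α j + p j ≤ s
  right : ∀ j ∈ R, Crosses w p t te α j → s < tstar w p α j

section

variable {n : ℕ} {w p : Fin n → ℝ}

/-- The initial right list is `breaks ++ others`, so dropping a prefix of `breaks` leaves the jobs
after α. The initial maximum `t` bans nothing, since no start time is below `t`. -/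
lemma findStarts_eq (a : Fin n) (l : List (Fin n)) (t : ℝ) :
    ∃ breaks others bans : List (Fin n),
      (findStarts w p (precompute w p).val a l t).val =
        (scan p (precompute w p).val (pivot w p a l t) (t + ((a :: l).map p).sum) breaks t t []
          (breaks ++ others) bans t).val ∧
      (bans.Pairwise fun x y => tstar w p (pivot w p a l t) x ≤ tstar w p (pivot w p a l t) y) ∧
      (breaks.Pairwise fun x y =>
        tstar w p (pivot w p a l t) x + p x ≤ tstar w p (pivot w p a l t) y + p y) ∧
      breaks.Nodup ∧ ((a :: l).Nodup → others.Nodup) ∧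
      (∀ j, j ∈ bans ↔ j ∈ a :: l ∧ j ≠ pivot w p a l t ∧
        Crosses w p t (t + ((a :: l).map p).sum) (pivot w p a l t) j) ∧
      (∀ j, j ∈ breaks ↔ j ∈ a :: l ∧ j ≠ pivot w p a l t ∧
        Crosses w p t (t + ((a :: l).map p).sum) (pivot w p a l t) j ∧
        tstar w p (pivot w p a l t) j + p j < t + ((a :: l).map p).sum) ∧
      (∀ j, j ∈ others ↔ j ∈ a :: l ∧ j ≠ pivot w p a l t ∧
        ¬ (Crosses w p t (t + ((a :: l).map p).sum) (pivot w p a l t) j ∧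
        tstar w p (pivot w p a l t) j + p j < t + ((a :: l).map p).sum)) := by
  have hmark (j : Fin n) : Function.update (mark (fun _ => false) (a :: l)).val (pivot w p a l t)
      false j = true ↔ j ∈ a :: l ∧ j ≠ pivot w p a l t := by
    by_cases h : j = pivot w p a l t
    · simp [h]
    · rw [Function.update_of_ne h, val_mark]
      simp [h]
  have hcross (j : Fin n) :
      (crossesIn (precompute w p).val (pivot w p a l t) t (t + ((a :: l).map p).sum) j).val = true ↔
        Crosses w p t (t + ((a :: l).map p).sum) (pivot w p a l t) j := by
    rw [val_crossesIn, val_precompute, Bool.and_eq_true, decide_eq_true_eq, decide_eq_true_eq]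
    rfl
  have hbreak (j : Fin n) :
      (isBreak (precompute w p).val (pivot w p a l t) t (t + ((a :: l).map p).sum) j).val = true ↔
        Crosses w p t (t + ((a :: l).map p).sum) (pivot w p a l t) j ∧
          tstar w p (pivot w p a l t) j + p j < t + ((a :: l).map p).sum := by
    rw [val_isBreak, val_precompute, Bool.and_eq_true, Bool.and_eq_true, decide_eq_true_eq,
      decide_eq_true_eq, decide_eq_true_eq]
    rfl
  refine ⟨((precompute w p).val.byExit (pivot w p a l t)).filter fun j =>
      Function.update (mark (fun _ => false) (a :: l)).val (pivot w p a l t) false j &&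
        (isBreak (precompute w p).val (pivot w p a l t) t (t + ((a :: l).map p).sum) j).val,
    (a :: l).filter fun j => !(eqIdx j (pivot w p a l t)).val &&
      !(isBreak (precompute w p).val (pivot w p a l t) t (t + ((a :: l).map p).sum) j).val,
    ((precompute w p).val.byCross (pivot w p a l t)).filter fun j =>
      Function.update (mark (fun _ => false) (a :: l)).val (pivot w p a l t) false j &&
        (crossesIn (precompute w p).val (pivot w p a l t) t (t + ((a :: l).map p).sum) j).val,
    ?_, ?_, ?_, ?_, ?_, ?_, ?_, ?_⟩
  · simp only [findStarts, val_bind, val_sumFrom, val_append, val_select]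
    rfl
  · refine List.Pairwise.filter _ ?_
    rw [val_precompute]
    exact mergeSort_sorted _ _ _ (by simp)
  · refine List.Pairwise.filter _ ?_
    rw [val_precompute]
    exact mergeSort_sorted _ _ _ (by simp)
  · refine List.Nodup.filter _ ?_
    rw [val_precompute]
    exact (mergeSort_perm _ _ _).nodup_iff.2 (List.nodup_finRange n)
  · exact List.Nodup.filter _
  · intro j
    have hj : j ∈ (precompute w p).val.byCross (pivot w p a l t) := by
      rw [val_precompute]
      exact (mergeSort_perm _ _ _).mem_iff.2 (List.mem_finRange j)
    rw [List.mem_filter, Bool.and_eq_true, hmark, hcross]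
    tauto
  · intro j
    have hj : j ∈ (precompute w p).val.byExit (pivot w p a l t) := by
      rw [val_precompute]
      exact (mergeSort_perm _ _ _).mem_iff.2 (List.mem_finRange j)
    rw [List.mem_filter, Bool.and_eq_true, hmark, hbreak]
    tauto
  · intro j
    rw [List.mem_filter, Bool.and_eq_true, Bool.not_eq_true', Bool.not_eq_true', val_eqIdx,
      decide_eq_false_iff_not, ← Bool.not_eq_true, hbreak]

lemma pivot_mem (a : Fin n) (l : List (Fin n)) (t : ℝ) : pivot w p a l t ∈ a :: l :=
  (findAlpha_spec w p t _ a l).1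

lemma phiGE_pivot {a j : Fin n} {l : List (Fin n)} (t : ℝ) (hj : j ∈ a :: l) :
    PhiGE w p t (t + ((a :: l).map p).sum) (pivot w p a l t) j :=
  (findAlpha_spec w p t _ a l).2 j hj

lemma findStarts_pairwise (hp : ∀ j, 0 < p j) (a : Fin n) (l : List (Fin n)) (t : ℝ) :
    (findStarts w p (precompute w p).val a l t).val.Pairwise (fun b b' => b.start < b'.start) := by
  obtain ⟨breaks, others, bans, h, -⟩ := findStarts_eq (w := w) (p := p) a l t
  rw [h]
  exact (scan_pairwise p hp _ _ _ _ _ _ _ _ _ _).1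

/-- Soundness of the search: the tests made by the scan imply the conditions of `Conforming`,
including for the crossing jobs that exit too late to be break points. -/
lemma mem_findStarts (hp : ∀ j, 0 < p j) {a : Fin n} {l : List (Fin n)} {t : ℝ}
    (hnd : (a :: l).Nodup) {br : Branch n}
    (hbr : br ∈ (findStarts w p (precompute w p).val a l t).val) :
    br.job = pivot w p a l t ∧ br.start = t + (br.left.map p).sum ∧
      (br.left ++ br.job :: br.right).Perm (a :: l) ∧
      Conforming w p t (t + ((a :: l).map p).sum) br.job br.start br.left br.right := by
  obtain ⟨breaks, others, bans, h, h1, h2, h3, h4, h5, h6, h7⟩ :=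
    findStarts_eq (w := w) (p := p) a l t
  have hα := pivot_mem (w := w) (p := p) a l t
  set α := pivot w p a l t
  set te := t + ((a :: l).map p).sum
  have hcr : (precompute w p).val.cross = tstar w p := by rw [val_precompute]
  have hex : (precompute w p).val.exit = fun i j => tstar w p i j + p j := by rw [val_precompute]
  rw [h, mem_scan_iff p hp _ _ _ _ _ _ _ _ _ _ _ (by rw [hcr]; exact h1) (by rw [hex]; exact h2)
    (by rw [hex]; exact fun j hj => ((h6 j).1 hj).2.2.2)
    (by
      rw [hex]
      intro j hj
      have h8 := ((h6 j).1 hj).2.2.1.1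
      have h9 := hp j
      simp only
      linarith)] at hbr
  obtain ⟨k₁, k₂, rfl, hbr, -, c1, c2, c3, c4⟩ := hbr
  simp only [hex] at c1 c2
  simp only [Banned, hcr, hex, not_or, not_exists, not_and, not_lt] at c4
  have hstart : br.start = t + (k₁.map p).sum := by rw [hbr]
  have hjob : br.job = α := by rw [hbr]
  have hleft : br.left = k₁.reverse := by rw [hbr]; simp
  have hright : br.right = k₂ ++ others := by rw [hbr]; simp
  rw [hjob, hleft, hright]
  have hmem (j : Fin n) : j ∈ k₂ ++ others → j ∈ a :: l ∧ j ≠ α := by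
    intro hj
    rcases List.mem_append.1 hj with hj | hj
    · have := (h6 j).1 (by simp [hj])
      exact ⟨this.1, this.2.1⟩
    · have := (h7 j).1 hj
      exact ⟨this.1, this.2.1⟩
  refine ⟨rfl, ?_, ?_, ?_, ?_⟩
  · rw [hstart, List.map_reverse, List.sum_reverse]
  · rw [List.perm_ext_iff_of_nodup _ hnd]
    · intro j
      constructor
      · intro hj
        rcases List.mem_append.1 hj with hj | hj
        · rw [List.mem_reverse] at hj
          exact ((h6 j).1 (List.mem_append_left _ hj)).1
        · rcases List.mem_cons.1 hj with rfl | hj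
          · exact hα
          · exact (hmem j hj).1
      · intro hj
        by_cases hne : j = α
        · rw [hne]
          exact List.mem_append_right _ List.mem_cons_self
        · by_cases hcr : Crosses w p t te α j ∧ tstar w p α j + p j < te
          · rcases List.mem_append.1 ((h6 j).2 ⟨hj, hne, hcr⟩) with hj | hj
            · exact List.mem_append_left _ (List.mem_reverse.2 hj)
            · exact List.mem_append_right _ (List.mem_cons_of_mem _ (List.mem_append_left _ hj))
          · exact List.mem_append_right _ (List.mem_cons_of_mem _
              (List.mem_append_right _ ((h7 j).2 ⟨hj, hne, hcr⟩)))
    · refine List.Nodup.append (by simpa using h3.of_append_left) ?_ ?_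
      · refine List.nodup_cons.2 ⟨fun hh => (hmem _ hh).2 rfl, ?_⟩
        refine List.Nodup.append h3.of_append_right (h4 hnd) fun j hj hj' => ?_
        exact ((h7 j).1 hj').2.2 ((h6 j).1 (by simp [hj])).2.2
      · intro j hj hj'
        rw [List.mem_reverse] at hj
        have e6 := (h6 j).1 (by simp [hj])
        rcases List.mem_cons.1 hj' with rfl | hj'
        · exact e6.2.1 rfl
        · rcases List.mem_append.1 hj' with hj' | hj'
          · exact (List.disjoint_of_nodup_append h3) hj hj'
          · exact ((h7 j).1 hj').2.2 e6.2.2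
  · intro j hj
    rw [List.mem_reverse] at hj
    exact ⟨((h6 j).1 (by simp [hj])).2.2.1, c1 j hj⟩
  · intro j hj hc
    have hj' := hmem j hj
    by_contra! hcon
    -- Having reached t*, an unbanned start time must also have reached c. This contradicts the cut
    -- if j is a later break point, and otherwise it would make j a break point, as the start is
    -- below `te`.
    have h8 := c4.2 j ((h5 j).2 ⟨hj'.1, hj'.2, hc⟩) hcon
    rcases List.mem_append.1 hj with hj | hj
    · exact absurd (c2 j hj) (not_lt.2 h8)
    · exact ((h7 j).1 hj).2.2 ⟨hc, h8.trans_lt c3⟩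

lemma eq_filter_append_filter {β : Type} {key : β → ℝ} {l : List β}
    (hl : l.Pairwise fun x y => key x ≤ key y) (s : ℝ) :
    l = (l.filter fun j => decide (key j ≤ s)) ++ l.filter fun j => !decide (key j ≤ s) := by
  induction l with
  | nil => rfl
  | cons j b ih =>
    have hl' := List.pairwise_cons.1 hl
    by_cases hj : key j ≤ s
    · rw [List.filter_cons_of_pos (by simpa using hj), List.filter_cons_of_neg (by simpa using hj),
        List.cons_append, ← ih hl'.2]
    · have hall : ∀ i ∈ b, ¬ key i ≤ s := fun i hi hle => hj ((hl'.1 i hi).trans hle)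
      rw [List.filter_cons_of_neg (by simpa using hj), List.filter_cons_of_pos (by simpa using hj),
        List.filter_eq_nil_iff.2 (by simpa using hall),
        List.filter_eq_self.2 (by simpa using hall), List.nil_append]

/-- Completeness of the search: for a conforming split, `L` consists precisely of the break points
that are at most the start time of α, hence is a prefix of the sorted break list. -/
lemma exists_mem_findStarts (hp : ∀ j, 0 < p j) {a : Fin n} {l : List (Fin n)} {t : ℝ}
    (hnd : (a :: l).Nodup) {L R : List (Fin n)}
    (hperm : (L ++ pivot w p a l t :: R).Perm (a :: l))
    (hconf : Conforming w p t (t + ((a :: l).map p).sum) (pivot w p a l t)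
      (t + (L.map p).sum) L R) :
    ∃ br ∈ (findStarts w p (precompute w p).val a l t).val,
      br.left.Perm L ∧ br.right.Perm R := by
  obtain ⟨breaks, others, bans, h, h1, h2, h3, h4, h5, h6, h7⟩ :=
    findStarts_eq (w := w) (p := p) a l t
  have hsum : t + (L.map p).sum < t + ((a :: l).map p).sum := by
    rw [← (hperm.map p).sum_eq]
    have := hp (pivot w p a l t)
    have := sum_nonneg_of_pos hp R
    simp
    linarith
  set α := pivot w p a l t
  set te := t + ((a :: l).map p).sum
  set s := t + (L.map p).sum
  have hcr : (precompute w p).val.cross = tstar w p := by rw [val_precompute]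
  have hex : (precompute w p).val.exit = fun i j => tstar w p i j + p j := by rw [val_precompute]
  have hnd' := hperm.nodup_iff.2 hnd
  have hLα : ∀ j ∈ L, j ∈ a :: l ∧ j ≠ α := fun j hj =>
    ⟨hperm.mem_iff.1 (by simp [hj]), fun h => by
      subst h
      exact (List.disjoint_of_nodup_append hnd') hj (by simp)⟩
  have hRα : ∀ j ∈ R, j ∈ a :: l ∧ j ≠ α := fun j hj =>
    ⟨hperm.mem_iff.1 (by simp [hj]), fun h => by
      subst h
      exact (List.nodup_cons.1 hnd'.of_append_right).1 hj⟩
  have hLR : ∀ j, j ∈ a :: l → j ≠ α → j ∈ L ∨ j ∈ R := fun j hj hne => by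
    have := hperm.mem_iff.2 hj
    simp only [List.mem_append, List.mem_cons] at this
    tauto
  set k₁ := breaks.filter fun j => decide (tstar w p α j + p j ≤ s) with hk₁
  set k₂ := breaks.filter fun j => !decide (tstar w p α j + p j ≤ s) with hk₂
  have hsplit : breaks = k₁ ++ k₂ := eq_filter_append_filter h2 s
  -- A crossing job in `R` has t* beyond `s`, hence also c beyond `s`; a job in `L` has c at most
  -- `s`, which is below `te`, so it is a break point.
  have hk₁L : k₁.Perm L := by
    rw [List.perm_ext_iff_of_nodup (h3.filter _) hnd'.of_append_left]
    intro j
    rw [List.mem_filter, h6, decide_eq_true_eq]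
    constructor
    · rintro ⟨⟨i1, i2, i3, -⟩, i5⟩
      refine (hLR j i1 i2).resolve_right fun hR => ?_
      have := hconf.right j hR i3
      have := hp j
      linarith
    · intro hj
      obtain ⟨i1, i2⟩ := hconf.left j hj
      exact ⟨⟨(hLα j hj).1, (hLα j hj).2, i1, i2.trans_lt hsum⟩, i2⟩
  have hs : t + (k₁.map p).sum = s := by rw [(hk₁L.map p).sum_eq]
  have hmem : (⟨α, s, k₁.reverse, k₂ ++ others⟩ : Branch n) ∈
      (findStarts w p (precompute w p).val a l t).val := by
    rw [h, mem_scan_iff p hp _ _ _ _ _ _ _ _ _ _ _ (by rw [hcr]; exact h1) (by rw [hex]; exact h2)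
      (by rw [hex]; exact fun j hj => ((h6 j).1 hj).2.2.2)
      (by
        rw [hex]
        intro j hj
        have h8 := ((h6 j).1 hj).2.2.1.1
        have h9 := hp j
        simp only
        linarith)]
    refine ⟨k₁, k₂, hsplit, ?_, ?_, ?_, ?_, hsum, ?_⟩
    · rw [hs, hsplit]
      simp
    · have := sum_nonneg_of_pos hp L
      simp only [s]
      linarith
    · intro j hj
      rw [hk₁, List.mem_filter, decide_eq_true_eq] at hj
      simpa only [hex] using hj.2
    · intro j hj
      rw [hk₂, List.mem_filter, Bool.not_eq_true', decide_eq_false_iff_not, not_le] at hj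
      simpa only [hex] using hj.2
    · simp only [Banned, hcr, hex, not_or, not_exists, not_and, not_lt]
      refine ⟨?_, fun j hj hjs => ?_⟩
      · have := sum_nonneg_of_pos hp L
        simp only [s]
        linarith
      · obtain ⟨i1, i2, i3⟩ := (h5 j).1 hj
        rcases hLR j i1 i2 with hL | hR
        · exact (hconf.left j hL).2
        · exact absurd (hconf.right j hR i3) (not_lt.2 hjs)
  refine ⟨_, hmem, (List.reverse_perm _).trans hk₁L, ?_⟩
  obtain ⟨-, -, hperm', -⟩ := mem_findStarts hp hnd hmem
  have h8 := hperm'.trans hperm.symm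
  -- Both splits partition the same jobs, so once the left sides agree the right sides follow by
  -- cancellation.
  have h9 : (L ++ α :: (k₂ ++ others)).Perm (L ++ α :: R) :=
    ((((List.reverse_perm _).trans hk₁L).symm.append_right _)).trans h8
  exact (List.perm_cons α).1 ((List.perm_append_left_iff L).1 h9)

end

/-! ### Optimality of the recursive procedure -/

section

variable {n : ℕ} {w p : Fin n → ℝ}

/-- The comparison of `φ_i` and `φ_j` is linear in time. -/
lemma phi_le_iff_linear (hp : ∀ j, 0 < p j) {i j : Fin n} {t : ℝ} (ht : 0 ≤ t) :
    phi w p j t ≤ phi w p i t ↔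
      w j * p i ^ 2 - w i * p j ^ 2 ≤ (w i * p j - w j * p i) * t := by
  rw [phi_le_iff hp ht]
  constructor <;> intro h <;> nlinarith

lemma phi_lt_iff_linear (hp : ∀ j, 0 < p j) {i j : Fin n} {t : ℝ} (ht : 0 ≤ t) :
    phi w p j t < phi w p i t ↔
      w j * p i ^ 2 - w i * p j ^ 2 < (w i * p j - w j * p i) * t := by
  rw [phi_lt_iff hp ht]
  constructor <;> intro h <;> nlinarith

lemma phi_lt_of_lt_tstar (hp : ∀ j, 0 < p j) {i j : Fin n} (hD : w i * p j - w j * p i < 0) {τ : ℝ}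
    (h0 : 0 ≤ τ) (hτ : τ < tstar w p i j) : phi w p j τ < phi w p i τ := by
  rw [phi_lt_iff_linear hp h0]
  rw [tstar, lt_div_iff_of_neg hD] at hτ
  linarith

lemma phi_le_of_tstar_le (hp : ∀ j, 0 < p j) {i j : Fin n} (hD : w i * p j - w j * p i < 0) {τ : ℝ}
    (h0 : 0 ≤ τ) (hτ : tstar w p i j ≤ τ) : phi w p i τ ≤ phi w p j τ := by
  refine not_lt.1 fun h => ?_
  rw [phi_lt_iff_linear hp h0] at h
  rw [tstar, div_le_iff_of_neg hD] at hτ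
  linarith

lemma phi_lt_of_tstar_lt (hp : ∀ j, 0 < p j) {i j : Fin n} (hD : w i * p j - w j * p i < 0) {τ : ℝ}
    (h0 : 0 ≤ τ) (hτ : tstar w p i j < τ) : phi w p i τ < phi w p j τ := by
  refine not_le.1 fun h => ?_
  rw [phi_le_iff_linear hp h0] at h
  rw [tstar, div_lt_iff_of_neg hD] at hτ
  linarith

lemma PhiGE.le {t te : ℝ} {i j : Fin n} (h : PhiGE w p t te i j) : phi w p j t ≤ phi w p i t :=
  h.elim le_of_lt fun h => h.1.le

/-- Since α leads at `t`, a crossing after `t` can only mean that α is overtaken, which fixes the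
sign of the slope. -/
lemma Crosses.neg (hp : ∀ j, 0 < p j) {t te : ℝ} (ht : 0 ≤ t) {i j : Fin n}
    (hc : Crosses w p t te i j) (h : PhiGE w p t te i j) : w i * p j - w j * p i < 0 := by
  have h1 := h.le
  rw [phi_le_iff_linear hp ht] at h1
  by_contra! hD
  have h2 := hc.1
  rcases hD.eq_or_lt with hD | hD
  -- With slope zero, t* has the default value 0, which cannot exceed `t ≥ 0`.
  · rw [tstar, ← hD, div_zero] at h2
    linarith
  · rw [tstar, lt_div_iff₀ hD] at h2
    linarith

/-- If the leader at `t` fell behind by `te`, the affine difference would have a zero strictly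
inside the interval, or else vanish at `t`. The tie-break at `te` rules out the latter. -/
lemma phi_le_of_not_crosses (hp : ∀ j, 0 < p j) {t te : ℝ} (ht : 0 ≤ t) {i j : Fin n}
    (hc : ¬ Crosses w p t te i j) (h : PhiGE w p t te i j) {τ : ℝ} (h1 : t ≤ τ) (h2 : τ ≤ te) :
    phi w p j τ ≤ phi w p i τ := by
  have hle := h.le
  rw [phi_le_iff_linear hp ht] at hle
  rw [phi_le_iff_linear hp (by linarith)]
  rcases le_or_gt 0 (w i * p j - w j * p i) with hD | hD
  · nlinarith
  · by_contra! hcon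
    have hte : (w i * p j - w j * p i) * te < w j * p i ^ 2 - w i * p j ^ 2 := by nlinarith
    rcases hle.eq_or_lt with heq | hlt
    · rcases h with h | h
      · rw [phi_lt_iff_linear hp ht] at h
        linarith
      · have := h.2
        rw [phi_le_iff_linear hp (by linarith)] at this
        linarith
    · refine hc ⟨?_, ?_⟩
      · rw [tstar, lt_div_iff_of_neg hD]
        linarith
      · rw [tstar, div_lt_iff_of_neg hD]
        linarith

/-- Any best schedule can be changed so that only jobs that cross `α` precede `α`. -/
lemma IsBest.exists_left_crosses (hw : ∀ j, 0 < w j) (hp : ∀ j, 0 < p j) {J : List (Fin n)} {t : ℝ}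
    (ht : 0 ≤ t) {α : Fin n} (hα : ∀ j ∈ J, PhiGE w p t (t + (J.map p).sum) α j)
    {L R : List (Fin n)} (h : IsBest w p J t (L ++ α :: R)) :
    ∃ L' R', IsBest w p J t (L' ++ α :: R') ∧ ∀ j ∈ L', Crosses w p t (t + (J.map p).sum) α j := by
  induction hm : L.length using Nat.strong_induction_on generalizing L R with
  | _ m ih =>
    by_cases hall : ∀ j ∈ L, Crosses w p t (t + (J.map p).sum) α j
    · exact ⟨L, R, h, hall⟩
    push Not at hall
    obtain ⟨j, hj, hjc⟩ := hall
    obtain ⟨A, B, rfl⟩ := List.append_of_mem hj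
    have hA := sum_nonneg_of_pos hp A
    have hB := sum_nonneg_of_pos hp B
    have hR := sum_nonneg_of_pos hp R
    have hpj := hp j
    have hpα := hp α
    have hsum := (h.1.map p).sum_eq
    simp only [List.map_append, List.map_cons, List.sum_append, List.sum_cons] at hsum
    have hG := hα j (h.1.mem_iff.1 (by simp))
    -- Either way α moves ahead of j: identical jobs trade places, and otherwise j must be the
    -- immediate predecessor of α, with a tie. The left part shrinks to `A`.
    by_cases hid : w α = w j ∧ p α = p j
    · have h' := h.swap_identical hid.1 hid.2
      rw [List.append_assoc, List.cons_append] at h'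
      exact ih A.length (by simp [← hm]) h' rfl
    · obtain ⟨rfl, -, h'⟩ := h.eq_nil_of_dominated hw hp ht
        (phi_le_of_not_crosses hp ht hjc hG (by linarith) (by linarith))
        (phi_le_of_not_crosses hp ht hjc hG (by linarith) (by linarith)) hid
      exact ih A.length (by simp [← hm]) h' rfl

lemma ne_of_neg {i j : Fin n} (hD : w i * p j - w j * p i < 0) : ¬ (w i = w j ∧ p i = p j) := by
  rintro ⟨h1, h2⟩
  rw [h1, h2] at hD
  linarith

/-- Were the start of α earlier, α would strictly beat j at both comparison times, whereas a best
order tolerates only a tie. No modification of the order is needed for this condition. -/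
lemma IsBest.tstar_add_le (hw : ∀ j, 0 < w j) (hp : ∀ j, 0 < p j) {J : List (Fin n)}
    {t : ℝ} (ht : 0 ≤ t) {α j : Fin n} (hD : w α * p j - w j * p α < 0) {L R : List (Fin n)}
    (h : IsBest w p J t (L ++ α :: R)) (hj : j ∈ L) :
    tstar w p α j + p j ≤ t + (L.map p).sum := by
  by_contra! hcon
  obtain ⟨A, B, rfl⟩ := List.append_of_mem hj
  have hA := sum_nonneg_of_pos hp A
  have hB := sum_nonneg_of_pos hp B
  have hpj := hp j
  simp only [List.map_append, List.map_cons, List.sum_append, List.sum_cons] at hcon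
  have h1 := phi_lt_of_lt_tstar hp hD (τ := t + (A.map p).sum) (by linarith) (by linarith)
  have h2 := phi_lt_of_lt_tstar hp hD (τ := t + (A.map p).sum + (B.map p).sum) (by linarith)
    (by linarith)
  have h3 := (h.eq_nil_of_dominated hw hp ht h1.le h2.le (ne_of_neg hD)).2.1
  exact h1.ne h3

/-- Any best schedule in which only jobs that cross `α` precede `α` can be changed into one that
obeys the dominance rule for `α`. -/
lemma IsBest.exists_conforming_of_left (hw : ∀ j, 0 < w j) (hp : ∀ j, 0 < p j) {J : List (Fin n)}
    {t : ℝ} (ht : 0 ≤ t) {α : Fin n} (hα : ∀ j ∈ J, PhiGE w p t (t + (J.map p).sum) α j)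
    {L R : List (Fin n)} (h : IsBest w p J t (L ++ α :: R))
    (hL : ∀ j ∈ L, Crosses w p t (t + (J.map p).sum) α j) :
    ∃ L' R', IsBest w p J t (L' ++ α :: R') ∧
      Conforming w p t (t + (J.map p).sum) α (t + (L'.map p).sum) L' R' := by
  induction hm : R.length using Nat.strong_induction_on generalizing L R with
  | _ m ih =>
    by_cases hall : ∀ j ∈ R, Crosses w p t (t + (J.map p).sum) α j →
        t + (L.map p).sum < tstar w p α j
    · refine ⟨L, R, h, fun j hj => ⟨hL j hj, ?_⟩, hall⟩
      exact h.tstar_add_le hw hp ht ((hL j hj).neg hp ht (hα j (h.1.mem_iff.1 (by simp [hj])))) hj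
    push Not at hall
    obtain ⟨j, hj, hjc, hle⟩ := hall
    have hD := hjc.neg hp ht (hα j (h.1.mem_iff.1 (by simp [hj])))
    obtain ⟨B, Z, rfl⟩ := List.append_of_mem hj
    have hLs := sum_nonneg_of_pos hp L
    have hB := sum_nonneg_of_pos hp B
    have h0 : L ++ α :: (B ++ j :: Z) = L ++ α :: B ++ j :: Z := by simp
    rw [h0] at h
    -- From the start of α on, j is at least as good, so j follows α directly with a tie and may be
    -- swapped before it. The left part still contains only crossing jobs, and the right part
    -- shrinks to `Z`.
    obtain ⟨rfl, -, h'⟩ := h.eq_nil_of_dominated hw hp ht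
      (phi_le_of_tstar_le hp hD (by linarith) hle)
      (phi_le_of_tstar_le hp hD (by linarith) (by linarith))
      (fun hh => ne_of_neg hD ⟨hh.1.symm, hh.2.symm⟩)
    rw [show L ++ j :: α :: Z = (L ++ [j]) ++ α :: Z by simp] at h'
    refine ih Z.length (by simp [← hm]) h' (fun i hi => ?_) rfl
    rcases List.mem_append.1 hi with hi | hi
    · exact hL i hi
    · rw [List.mem_singleton.1 hi]
      exact hjc

/-- This serves both optimality and counting: some branch contains a best order, and in particular
the list of branches is never empty. -/
lemma exists_isBest_branch (hw : ∀ j, 0 < w j) (hp : ∀ j, 0 < p j) {a : Fin n} {l : List (Fin n)}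
    (hnd : (a :: l).Nodup) {t : ℝ} (ht : 0 ≤ t) :
    ∃ br ∈ (findStarts w p (precompute w p).val a l t).val, ∃ L R : List (Fin n),
      L.Perm br.left ∧ R.Perm br.right ∧ IsBest w p (a :: l) t (L ++ br.job :: R) := by
  obtain ⟨S, hS⟩ := exists_isBest w p (a :: l) t
  have hα : ∀ j ∈ a :: l, PhiGE w p t (t + ((a :: l).map p).sum) (pivot w p a l t) j :=
    fun j hj => phiGE_pivot t hj
  obtain ⟨L, R, rfl⟩ := List.append_of_mem (hS.1.mem_iff.2 (pivot_mem (w := w) (p := p) a l t))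
  obtain ⟨L, R, hS, hL⟩ := hS.exists_left_crosses hw hp ht hα
  obtain ⟨L, R, hS, hconf⟩ := hS.exists_conforming_of_left hw hp ht hα hL
  obtain ⟨br, hbr, h1, h2⟩ := exists_mem_findStarts hp hnd hS.1 hconf
  refine ⟨br, hbr, L, R, h1.symm, h2.symm, ?_⟩
  rw [(mem_findStarts hp hnd hbr).1]
  exact hS

lemma val_foldlM {β γ : Type} (f : β → γ → Timed β) (b : β) (l : List γ) :
    (l.foldlM f b).val = l.foldl (fun b c => (f b c).val) b := by
  induction l generalizing b with
  | nil => rfl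
  | cons c l ih => exact ih _

lemma foldl_improve {β γ : Type} (v : γ → ℝ) (s : γ → β) (b : ℝ × β) (l : List γ) :
    b.1 ≤ (l.foldl (fun b c => if b.1 < v c then (v c, s c) else b) b).1 ∧
      (∀ c ∈ l, v c ≤ (l.foldl (fun b c => if b.1 < v c then (v c, s c) else b) b).1) ∧
      (l.foldl (fun b c => if b.1 < v c then (v c, s c) else b) b = b ∨
        ∃ c ∈ l, l.foldl (fun b c => if b.1 < v c then (v c, s c) else b) b = (v c, s c)) := by
  induction l generalizing b with
  | nil => simp
  | cons c l ih =>
    simp only [List.foldl_cons]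
    obtain ⟨h1, h2, h3⟩ := ih (if b.1 < v c then (v c, s c) else b)
    have h4 : b.1 ≤ (if b.1 < v c then (v c, s c) else b).1 ∧
        v c ≤ (if b.1 < v c then (v c, s c) else b).1 := by
      split_ifs with h
      · exact ⟨h.le, le_rfl⟩
      · exact ⟨le_rfl, not_lt.1 h⟩
    refine ⟨h4.1.trans h1, fun d hd => ?_, ?_⟩
    · rcases List.mem_cons.1 hd with rfl | hd
      · exact h4.2.trans h1
      · exact h2 d hd
    · rcases h3 with h3 | ⟨d, hd, h3⟩
      · rw [h3]
        split_ifs with h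
        · exact Or.inr ⟨c, by simp, rfl⟩
        · exact Or.inl rfl
      · exact Or.inr ⟨d, by simp [hd], h3⟩

lemma val_fastSchedule (T : Tables n) (d : ℕ) (a b : Fin n) (l : List (Fin n)) (t : ℝ) :
    (fastSchedule w p T (d + 1) (a :: b :: l) t).val =
      (findStarts w p T a (b :: l) t).val.foldl (fun best br =>
        if best.1 < (fastSchedule w p T d br.left t).val.1 +
            (fastSchedule w p T d br.right (p br.job + br.start)).val.1 +
              w br.job / (p br.job + br.start) then
          ((fastSchedule w p T d br.left t).val.1 +
            (fastSchedule w p T d br.right (p br.job + br.start)).val.1 +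
              w br.job / (p br.job + br.start),
            (fastSchedule w p T d br.left t).val.2 ++
              br.job :: (fastSchedule w p T d br.right (p br.job + br.start)).val.2)
        else best) (0, []) := by
  rw [fastSchedule, val_bind, val_bind, val_foldlM]
  congr 1
  funext best br
  simp only [val_bind, val_ite, val_read, val_addR, val_divR, val_ltR, val_pure, val_append,
    decide_eq_true_eq]

lemma Branch.length_lt {J : List (Fin n)} {br : Branch n}
    (h : (br.left ++ br.job :: br.right).Perm J) :
    br.left.length < J.length ∧ br.right.length < J.length := by
  have := h.length_eq
  simp at this
  omega

/-- `FastSchedule` is correct. -/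
theorem fastSchedule_isBest (hw : ∀ j, 0 < w j) (hp : ∀ j, 0 < p j) (d : ℕ) (J : List (Fin n))
    (t : ℝ) (hd : J.length ≤ d) (hnd : J.Nodup) (ht : 0 ≤ t) :
    IsBest w p J t (fastSchedule w p (precompute w p).val d J t).val.2 ∧
      (fastSchedule w p (precompute w p).val d J t).val.1 =
        value w p t (fastSchedule w p (precompute w p).val d J t).val.2 := by
  induction d generalizing J t with
  | zero =>
    obtain rfl := List.length_eq_zero_iff.1 (Nat.le_zero.1 hd)
    simp [fastSchedule, IsBest, value]
  | succ d ih =>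
    match J with
    | [] => simp [fastSchedule, IsBest, value]
    | [j] => simp [fastSchedule, IsBest, value]
    | a :: b :: l =>
      set v : Branch n → ℝ := fun br => (fastSchedule w p (precompute w p).val d br.left t).val.1 +
            (fastSchedule w p (precompute w p).val d br.right (p br.job + br.start)).val.1 +
              w br.job / (p br.job + br.start) with hv
      set s : Branch n → List (Fin n) := fun br =>
            (fastSchedule w p (precompute w p).val d br.left t).val.2 ++
              br.job :: (fastSchedule w p (precompute w p).val d br.right
                (p br.job + br.start)).val.2 with hs
      have hval := val_fastSchedule (w := w) (p := p) (precompute w p).val d a b l t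
      change _ = List.foldl (fun best br => if best.1 < v br then (v br, s br) else best) _ _ at hval
      rw [hval]
      -- A branch fixes the set of jobs before α and hence the start of the right side, so the two
      -- sides can be optimised independently.
      have key : ∀ br ∈ (findStarts w p (precompute w p).val a (b :: l) t).val,
          v br = value w p t (s br) ∧ (s br).Perm (a :: b :: l) ∧
            ∀ L R : List (Fin n), L.Perm br.left → R.Perm br.right →
              value w p t (L ++ br.job :: R) ≤ v br := by
        intro br hbr
        obtain ⟨-, h2, h3, -⟩ := mem_findStarts hp hnd hbr
        have hlen := Branch.length_lt h3
        have hnd' := h3.nodup_iff.2 hnd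
        have h0 : 0 ≤ p br.job + br.start := by
          have := sum_nonneg_of_pos hp br.left
          have := hp br.job
          linarith
        obtain ⟨l1, l2⟩ := ih br.left t (by omega) hnd'.of_append_left ht
        obtain ⟨r1, r2⟩ := ih br.right (p br.job + br.start) (by omega)
          (List.nodup_cons.1 hnd'.of_append_right).2 h0
        have hcomb (L R : List (Fin n)) (hL : L.Perm br.left) :
            value w p t (L ++ br.job :: R) = value w p t L + value w p (p br.job + br.start) R +
              w br.job / (p br.job + br.start) := by
          rw [value_append, value, (hL.map p).sum_eq, ← h2]
          ring
        refine ⟨?_, ?_, fun L R hL hR => ?_⟩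
        · simp only [hs]
          rw [hcomb _ _ l1.1, ← l2, ← r2]
        · exact (l1.1.append (r1.1.cons _)).trans h3
        · rw [hcomb _ _ hL]
          have := l1.2 L hL
          have := r1.2 R hR
          simp only [hv]
          linarith
      obtain ⟨br, hbr, L, R, hL, hR, hbest⟩ := exists_isBest_branch hw hp hnd ht
      obtain ⟨-, f2, f3⟩ := foldl_improve v s (0, [])
        (findStarts w p (precompute w p).val a (b :: l) t).val
      set res := List.foldl (fun best br => if best.1 < v br then (v br, s br) else best)
        ((0 : ℝ), ([] : List (Fin n))) (findStarts w p (precompute w p).val a (b :: l) t).val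
      have hge := ((key br hbr).2.2 L R hL hR).trans (f2 br hbr)
      have hpos : 0 < value w p t (L ++ br.job :: R) := by
        refine lt_of_lt_of_le ?_ (hbest.2 (a :: b :: l) (List.Perm.refl _))
        have h1 := hw a
        have h2 := hp a
        have := value_nonneg hw hp (t := p a + t) (by linarith) (b :: l)
        rw [value]
        positivity
      rcases f3 with f3 | ⟨c, hc, f3⟩
      · rw [f3] at hge
        simp only at hge
        linarith
      · obtain ⟨k1, k2, -⟩ := key c hc
        rw [f3] at hge ⊢
        refine ⟨⟨k2, fun S' hS' => (hbest.2 S' hS').trans (hge.trans_eq k1)⟩, k1⟩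

lemma startTime_cons_self (t : ℝ) (j : Fin n) (S : List (Fin n)) :
    startTime p t (j :: S) j = t := by
  simp [startTime]

lemma startTime_cons_of_ne (t : ℝ) {i j : Fin n} (h : i ≠ j) (S : List (Fin n)) :
    startTime p t (j :: S) i = startTime p (p j + t) S i := by
  simp only [startTime, List.idxOf_cons_ne S (Ne.symm h), List.take_succ_cons, List.map_cons,
    List.sum_cons]
  ring

lemma cost_eq_neg_value {S : List (Fin n)} (hS : S.Nodup) (t : ℝ) :
    cost w p t S = -value w p t S := by
  induction S generalizing t with
  | nil => simp [cost, value]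
  | cons j S ih =>
    obtain ⟨h1, h2⟩ := List.nodup_cons.1 hS
    have := ih h2 (p j + t)
    rw [value, neg_add, ← this]
    simp only [cost, List.map_cons, List.sum_cons, completionTime, startTime_cons_self]
    congr 1
    · rw [neg_div, add_comm t]
    · congr 1
      refine List.map_congr_left fun i hi => ?_
      rw [startTime_cons_of_ne]
      rintro rfl
      exact h1 hi

theorem solve_isOptimal (hw : ∀ j, 0 < w j) (hp : ∀ j, 0 < p j) :
    IsOptimal w p (solve w p).val.2 ∧ (solve w p).val.1 = -cost w p 0 (solve w p).val.2 := by
  have hsolve : (solve w p).val =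
      (fastSchedule w p (precompute w p).val n (List.finRange n) 0).val := rfl
  obtain ⟨h1, h2⟩ := fastSchedule_isBest hw hp n (List.finRange n) 0 (by simp)
    (List.nodup_finRange n) le_rfl
  rw [hsolve]
  have hnd {S : List (Fin n)} (hS : IsSchedule S) : S.Nodup := hS.nodup_iff.2 (List.nodup_finRange n)
  refine ⟨⟨h1.1, fun S' hS' => ?_⟩, ?_⟩
  · rw [cost_eq_neg_value (hnd h1.1), cost_eq_neg_value (hnd hS')]
    exact neg_le_neg (h1.2 S' hS')
  · rw [cost_eq_neg_value (hnd h1.1), neg_neg, h2]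

end

/-! ### Branch choices yield distinct potential schedules -/

/-- All schedules that arise from choosing one branch in every recursive call. -/
def leaves {n : ℕ} (w p : Fin n → ℝ) : ℕ → List (Fin n) → ℝ → List (List (Fin n))
  | _, [], _ => [[]]
  | 0, _ :: _, _ => []
  | _ + 1, [j], _ => [[j]]
  | d + 1, a :: b :: l, t =>
    (findStarts w p (precompute w p).val a (b :: l) t).val.flatMap fun br =>
      (leaves w p d br.left t).flatMap fun L =>
        (leaves w p d br.right (p br.job + br.start)).map fun R => L ++ br.job :: R

/-- Whenever `x` precedes `y`, there is a moment between the start of `x` and `p_x` before the start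
of `y` just after which `φ_x ≥ φ_y`. -/
def Consistent {n : ℕ} (w p : Fin n → ℝ) (t : ℝ) (S : List (Fin n)) : Prop :=
  ∀ x ∈ S, ∀ y ∈ S, startTime p t S x ≤ startTime p t S y - p x →
    ∃ τ, startTime p t S x ≤ τ ∧ τ ≤ startTime p t S y - p x ∧
      ∀ᶠ s in nhdsWithin τ (Set.Ioi τ), phi w p y s ≤ phi w p x s

section

variable {n : ℕ} {w p : Fin n → ℝ}

lemma startTime_append_of_mem (t : ℝ) {A : List (Fin n)} (B : List (Fin n)) {j : Fin n}
    (h : j ∈ A) : startTime p t (A ++ B) j = startTime p t A j := by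
  simp only [startTime, List.idxOf_append_of_mem h]
  rw [List.take_append_of_le_length (List.idxOf_lt_length_of_mem h).le]

lemma startTime_append_of_notMem (t : ℝ) {A : List (Fin n)} (B : List (Fin n)) {j : Fin n}
    (h : j ∉ A) : startTime p t (A ++ B) j = startTime p (t + (A.map p).sum) B j := by
  simp only [startTime, List.idxOf_append_of_notMem h]
  rw [List.take_length_add_append, List.map_append, List.sum_append, add_assoc]

lemma startTime_append_cons_self (t : ℝ) {A : List (Fin n)} (B : List (Fin n)) {j : Fin n}
    (h : j ∉ A) : startTime p t (A ++ j :: B) j = t + (A.map p).sum := by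
  rw [startTime_append_of_notMem t _ h, startTime_cons_self]

lemma le_startTime (hp : ∀ j, 0 < p j) (t : ℝ) (S : List (Fin n)) (j : Fin n) :
    t ≤ startTime p t S j := by
  have := sum_nonneg_of_pos hp (S.take (S.idxOf j))
  unfold startTime
  linarith

lemma startTime_add_le (hp : ∀ j, 0 < p j) (t : ℝ) {S : List (Fin n)} {j : Fin n} (hj : j ∈ S) :
    startTime p t S j + p j ≤ t + (S.map p).sum := by
  obtain ⟨A, B, rfl, hA⟩ := List.eq_append_cons_of_mem hj
  have := sum_nonneg_of_pos hp B
  rw [startTime_append_cons_self t _ hA]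
  simp
  linarith

/-- An affine function that is nonnegative on [0, ∞) and vanishes at an interior point is
identically zero. Then φ_i = φ_j, which forces equal weights. -/
lemma phi_lt_of_forall_le (hp : ∀ j, 0 < p j) {i j : Fin n} (hne : w i ≠ w j)
    (h : ∀ t, 0 ≤ t → phi w p j t ≤ phi w p i t) {s : ℝ} (hs : 0 < s) :
    phi w p j s < phi w p i s := by
  rw [phi_lt_iff_linear hp hs.le]
  by_contra! hcon
  have h0 := (phi_le_iff_linear hp le_rfl).1 (h 0 le_rfl)
  have h1 := (phi_le_iff_linear hp hs.le).1 (h s hs.le)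
  have h2 := (phi_le_iff_linear hp (by linarith)).1 (h (2 * s) (by linarith))
  have hi := hp i
  have hj := hp j
  have hD : (w i * p j - w j * p i) * s = 0 := by linarith
  have hD' : w i * p j - w j * p i = 0 := by
    rcases mul_eq_zero.1 hD with h | h
    · exact h
    · exact absurd h hs.ne'
  have hN : w j * p i * (p i - p j) = 0 := by linear_combination hD + hD' * p j - hcon.antisymm h1
  have hw : w i * p j = w j * p j := by
    rcases mul_eq_zero.1 hN with h | h
    · rcases mul_eq_zero.1 h with h | h
      · rw [h] at hD' ⊢
        linarith
      · exact absurd h hi.ne'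
    · rw [sub_eq_zero.1 h] at hD'
      linarith
  have hj0 : p j ≠ 0 := ne_of_gt hj
  exact hne (mul_right_cancel₀ hj0 hw)

/-- Wherever the dominance rule prefers `i` to `j`, `φ_i` is larger just afterwards. -/
lemma Rule.eventually_lt (hw : ∀ j, 0 < w j) (hp : ∀ j, 0 < p j) {i j : Fin n} {I : Set ℝ} (h : Rule w p i j I)
    {τ : ℝ} (hτ : τ ∈ I) (h0 : 0 ≤ τ) :
    ∀ᶠ s in nhdsWithin τ (Set.Ioi τ), phi w p j s < phi w p i s := by
  have hpos : ∀ᶠ s in nhdsWithin τ (Set.Ioi τ), τ < s := self_mem_nhdsWithin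
  -- If w_i < w_j and the slope were nonnegative, then p_i < p_j and φ_i would dominate everywhere.
  -- So in the third case of the rule, j overtakes i.
  have hneg {i j : Fin n} (hlt : w i < w j) (h₁ : ¬ ∀ t, 0 ≤ t → phi w p j t ≤ phi w p i t) :
      w i * p j - w j * p i < 0 := by
    have hi := hp i
    have hj := hp j
    by_contra! hD
    refine h₁ fun t ht => ?_
    rw [phi_le_iff_linear hp ht]
    have hwi := hw i
    have hpp : p i < p j := lt_of_mul_lt_mul_left (a := w j)
      (by nlinarith [mul_lt_mul_of_pos_right hlt hj]) (hw j).le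
    have h1 : w j * p i * p i ≤ w i * p j * p i := mul_le_mul_of_nonneg_right (by linarith) hi.le
    have h2 : w i * p j * p i ≤ w i * p j * p j := mul_le_mul_of_nonneg_left hpp.le (by positivity)
    have h3 := mul_nonneg hD ht
    linarith
  cases h with
  | first _ _ hw h =>
    filter_upwards [hpos] with s hs
    exact phi_lt_of_forall_le hp hw.ne h (by linarith)
  | second _ _ hw h =>
    filter_upwards [hpos] with s hs
    exact phi_lt_of_forall_le hp hw.ne' h (by linarith)
  | early _ _ hw h₁ h₂ =>
    have hlt : ∀ᶠ s in nhdsWithin τ (Set.Ioi τ), s < tstar w p i j :=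
      nhdsWithin_le_nhds (Iio_mem_nhds hτ.2)
    filter_upwards [hpos, hlt] with s hs hs'
    exact phi_lt_of_lt_tstar hp (hneg hw h₁) (by linarith) hs'
  | late _ _ hw h₁ h₂ =>
    filter_upwards [hpos] with s hs
    exact phi_lt_of_tstar_lt hp (hneg hw h₁) (by linarith) (lt_of_le_of_lt hτ hs)

lemma Rule.ordConnected {i j : Fin n} {I : Set ℝ} (h : Rule w p i j I) : I.OrdConnected := by
  cases h <;> infer_instance

/-- The interval of a rule contains the moment τ supplied by consistency. Just after τ the rule is
strict, which contradicts the weak reverse inequality; at τ itself there might be a tie. -/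
lemma Consistent.isPotential (hw : ∀ j, 0 < w j) (hp : ∀ j, 0 < p j) {t : ℝ} (ht : 0 ≤ t) {S : List (Fin n)}
    (h : Consistent w p t S) : IsPotential w p t S := by
  rintro i j I hI ⟨hi, hj, hle, h1, h2⟩
  obtain ⟨τ, h3, h4, h5⟩ := h j hj i hi hle
  have hτ : τ ∈ I := hI.ordConnected.out h1 h2 ⟨h3, h4⟩
  have h6 := hI.eventually_lt hw hp hτ (by have := le_startTime hp t S j; linarith)
  obtain ⟨s, hs, hs'⟩ := (h5.and h6).exists
  exact absurd hs (not_le.2 hs')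

/-- Pairs on one side are inherited. For pairs involving α or both sides, the moment τ is the start
of α, or p_x before it when x precedes α; across the sides α acts as intermediary. -/
lemma consistent_append_cons (hp : ∀ j, 0 < p j) {t : ℝ} (ht : 0 ≤ t) {J L R : List (Fin n)}
    {α : Fin n} (hnd : J.Nodup) (hperm : (L ++ α :: R).Perm J)
    (hα : ∀ j ∈ J, PhiGE w p t (t + (J.map p).sum) α j)
    (hconf : Conforming w p t (t + (J.map p).sum) α (t + (L.map p).sum) L R)
    (hL : Consistent w p t L) (hR : Consistent w p (p α + (t + (L.map p).sum)) R) :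
    Consistent w p t (L ++ α :: R) := by
  have hnd' := hperm.nodup_iff.2 hnd
  have hdisj := List.disjoint_of_nodup_append hnd'
  have hαL : α ∉ L := fun h => hdisj h (by simp)
  have hαR : α ∉ R := (List.nodup_cons.1 hnd'.of_append_right).1
  have hRL : ∀ j ∈ R, j ∉ L := fun j hj h => hdisj h (by simp [hj])
  have hpα := hp α
  have hLs := sum_nonneg_of_pos hp L
  have hsum : (J.map p).sum = (L.map p).sum + (p α + (R.map p).sum) := by
    rw [← (hperm.map p).sum_eq]
    simp
  have hRs := sum_nonneg_of_pos hp R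
  have sL : ∀ j ∈ L, startTime p t (L ++ α :: R) j = startTime p t L j :=
    fun j hj => startTime_append_of_mem t _ hj
  have sα : startTime p t (L ++ α :: R) α = t + (L.map p).sum :=
    startTime_append_cons_self t _ hαL
  have sR : ∀ j ∈ R, startTime p t (L ++ α :: R) j =
      startTime p (p α + (t + (L.map p).sum)) R j := fun j hj => by
    rw [startTime_append_of_notMem t _ (hRL j hj), startTime_cons_of_ne]
    rintro rfl
    exact hαR hj
  -- Up to its own start, α beats every later job: a crossing job overtakes only after that start,
  -- and any other job does not exceed α before `t_e`.
  have domR : ∀ j ∈ R, ∀ τ, t ≤ τ → τ ≤ t + (L.map p).sum →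
      ∀ᶠ s in nhdsWithin τ (Set.Ioi τ), phi w p j s ≤ phi w p α s := by
    intro j hj τ h1 h2
    have hG := hα j (hperm.mem_iff.1 (by simp [hj]))
    have hpos : ∀ᶠ s in nhdsWithin τ (Set.Ioi τ), τ < s := self_mem_nhdsWithin
    by_cases hc : Crosses w p t (t + (J.map p).sum) α j
    · have hlt : ∀ᶠ s in nhdsWithin τ (Set.Ioi τ), s < tstar w p α j :=
        nhdsWithin_le_nhds (Iio_mem_nhds (h2.trans_lt (hconf.right j hj hc)))
      filter_upwards [hpos, hlt] with s hs hs'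
      exact (phi_lt_of_lt_tstar hp (hc.neg hp ht hG) (by linarith) hs').le
    · have hlt : ∀ᶠ s in nhdsWithin τ (Set.Ioi τ), s < t + (J.map p).sum :=
        nhdsWithin_le_nhds (Iio_mem_nhds (by linarith))
      filter_upwards [hpos, hlt] with s hs hs'
      exact phi_le_of_not_crosses hp ht hc hG (by linarith) hs'.le
  -- Conformity places p_j before the start of α at or beyond t*, so j has already caught up with α
  -- there.
  have domL : ∀ j ∈ L, ∀ᶠ s in nhdsWithin (t + (L.map p).sum - p j)
      (Set.Ioi (t + (L.map p).sum - p j)), phi w p α s ≤ phi w p j s := by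
    intro j hj
    have hG := hα j (hperm.mem_iff.1 (by simp [hj]))
    obtain ⟨hc, hle⟩ := hconf.left j hj
    have hlt : ∀ᶠ s in nhdsWithin (t + (L.map p).sum - p j)
      (Set.Ioi (t + (L.map p).sum - p j)), t + (L.map p).sum - p j < s := self_mem_nhdsWithin
    filter_upwards [hlt] with s hs
    have := hc.1
    exact phi_le_of_tstar_le hp (hc.neg hp ht hG) (by linarith) (by linarith)
  intro x hx₀ y hy₀ hxy
  rcases List.mem_append.1 hx₀ with hx | hx
  · have x1 := startTime_add_le hp t hx
    have x2 := le_startTime hp t L x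
    rw [sL x hx] at hxy ⊢
    rcases List.mem_append.1 hy₀ with hy | hy
    · rw [sL y hy] at hxy ⊢
      exact hL x hx y hy hxy
    · rcases List.mem_cons.1 hy with hy | hy
      · rw [hy, sα]
        exact ⟨t + (L.map p).sum - p x, by linarith, le_rfl, domL x hx⟩
      · rw [sR y hy] at hxy ⊢
        have y2 := le_startTime hp (p α + (t + (L.map p).sum)) R y
        -- The moment at which x is compared with α also serves for comparing α with y, so
        -- transitivity applies.
        refine ⟨t + (L.map p).sum - p x, by linarith, by linarith, ?_⟩
        have hpx := hp x
        filter_upwards [domL x hx, domR y hy (t + (L.map p).sum - p x) (by linarith)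
          (by linarith)] with s h1 h2
        exact h2.trans h1
  · rcases List.mem_cons.1 hx with hx | hx
    · rw [hx, sα] at hxy ⊢
      rcases List.mem_append.1 hy₀ with hy | hy
      · rw [sL y hy] at hxy
        have y1 := startTime_add_le hp t hy
        have := hp y
        linarith
      · rcases List.mem_cons.1 hy with hy | hy
        · rw [hy, sα] at hxy
          linarith
        · rw [sR y hy] at hxy ⊢
          exact ⟨t + (L.map p).sum, le_rfl, hxy, domR y hy _ (by linarith) le_rfl⟩
    · rw [sR x hx] at hxy ⊢
      have x2 := le_startTime hp (p α + (t + (L.map p).sum)) R x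
      have hpx := hp x
      rcases List.mem_append.1 hy₀ with hy | hy
      · rw [sL y hy] at hxy
        have y1 := startTime_add_le hp t hy
        have := hp y
        linarith
      · rcases List.mem_cons.1 hy with hy | hy
        · rw [hy, sα] at hxy
          linarith
        · rw [sR y hy] at hxy ⊢
          exact hR x hx y hy hxy

lemma mem_leaves_iff {d : ℕ} {a b : Fin n} {l : List (Fin n)} {t : ℝ} {S : List (Fin n)} :
    S ∈ leaves w p (d + 1) (a :: b :: l) t ↔
      ∃ br ∈ (findStarts w p (precompute w p).val a (b :: l) t).val,
        ∃ L ∈ leaves w p d br.left t, ∃ R ∈ leaves w p d br.right (p br.job + br.start),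
          L ++ br.job :: R = S := by
  simp [leaves]

lemma right_start_nonneg (hp : ∀ j, 0 < p j) {a : Fin n} {l : List (Fin n)} {t : ℝ} (ht : 0 ≤ t)
    (hnd : (a :: l).Nodup) {br : Branch n}
    (hbr : br ∈ (findStarts w p (precompute w p).val a l t).val) : 0 ≤ p br.job + br.start := by
  have := (mem_findStarts hp hnd hbr).2.1
  have := sum_nonneg_of_pos hp br.left
  have := hp br.job
  linarith

/-- Every choice of branches yields an order of the given jobs that obeys the dominance rule. -/
lemma leaves_spec (hp : ∀ j, 0 < p j) (d : ℕ) {J : List (Fin n)} {t : ℝ} (hnd : J.Nodup)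
    (ht : 0 ≤ t) {S : List (Fin n)} (hS : S ∈ leaves w p d J t) :
    S.Perm J ∧ Consistent w p t S := by
  induction d generalizing J t S with
  | zero =>
    cases J with
    | nil => simp [leaves] at hS; simp [hS, Consistent]
    | cons => simp [leaves] at hS
  | succ d ih =>
    match J with
    | [] => simp [leaves] at hS; simp [hS, Consistent]
    | [j] =>
      simp only [leaves, List.mem_singleton] at hS
      subst hS
      refine ⟨List.Perm.refl _, fun x hx y hy hxy => ?_⟩
      rw [List.mem_singleton] at hx hy
      rw [hx, hy] at hxy
      have := hp j
      linarith
    | a :: b :: l =>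
      obtain ⟨br, hbr, L, hL, R, hR, rfl⟩ := mem_leaves_iff.1 hS
      obtain ⟨h1, h2, h3, h4⟩ := mem_findStarts hp hnd hbr
      have hnd' := h3.nodup_iff.2 hnd
      obtain ⟨l1, l2⟩ := ih hnd'.of_append_left ht hL
      obtain ⟨r1, r2⟩ := ih (List.nodup_cons.1 hnd'.of_append_right).2
        (right_start_nonneg hp ht hnd hbr) hR
      have hperm := (l1.append (r1.cons br.job)).trans h3
      have hs : br.start = t + (L.map p).sum := by rw [h2, (l1.map p).sum_eq]
      rw [hs] at h4 r2
      refine ⟨hperm, consistent_append_cons hp ht hnd hperm (fun j hj => ?_)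
        ⟨fun j hj => h4.left j (l1.mem_iff.1 hj), fun j hj => h4.right j (r1.mem_iff.1 hj)⟩ l2 r2⟩
      rw [h1]
      exact phiGE_pivot t hj

/-- No call is a dead end. This permits completing any branch to a full schedule, and charging the
cost of each call to its leaves. -/
lemma leaves_ne_nil (hw : ∀ j, 0 < w j) (hp : ∀ j, 0 < p j) (d : ℕ) {J : List (Fin n)} {t : ℝ}
    (hd : J.length ≤ d) (hnd : J.Nodup) (ht : 0 ≤ t) : leaves w p d J t ≠ [] := by
  induction d generalizing J t with
  | zero =>
    obtain rfl := List.length_eq_zero_iff.1 (Nat.le_zero.1 hd)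
    simp [leaves]
  | succ d ih =>
    match J with
    | [] => simp [leaves]
    | [j] => simp [leaves]
    | a :: b :: l =>
      obtain ⟨br, hbr, -⟩ := exists_isBest_branch hw hp hnd ht
      have h3 := (mem_findStarts hp hnd hbr).2.2.1
      have hlen := Branch.length_lt h3
      have hnd' := h3.nodup_iff.2 hnd
      obtain ⟨L, hL⟩ := List.exists_mem_of_ne_nil _
        (ih (J := br.left) (by omega) hnd'.of_append_left ht)
      obtain ⟨R, hR⟩ := List.exists_mem_of_ne_nil _
        (ih (J := br.right) (by omega) (List.nodup_cons.1 hnd'.of_append_right).2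
          (right_start_nonneg hp ht hnd hbr))
      exact List.ne_nil_of_mem (mem_leaves_iff.2 ⟨br, hbr, L, hL, R, hR, rfl⟩)

/-- Leaves of different branches differ in the start time of the pivot. Within a branch all left
parts have the same length, so both sides can be read off from the concatenation. -/
lemma leaves_nodup (hp : ∀ j, 0 < p j) (d : ℕ) {J : List (Fin n)} {t : ℝ} (hnd : J.Nodup)
    (ht : 0 ≤ t) : (leaves w p d J t).Nodup := by
  induction d generalizing J t with
  | zero => cases J <;> simp [leaves]
  | succ d ih =>
    match J with
    | [] => simp [leaves]
    | [j] => simp [leaves]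
    | a :: b :: l =>
      rw [leaves, List.nodup_flatMap]
      constructor
      · intro br hbr
        have h3 := (mem_findStarts hp hnd hbr).2.2.1
        have hnd' := h3.nodup_iff.2 hnd
        have hndL := hnd'.of_append_left
        rw [List.nodup_flatMap]
        constructor
        · intro L hL
          refine (ih (List.nodup_cons.1 hnd'.of_append_right).2
            (right_start_nonneg hp ht hnd hbr)).map fun R R' h => ?_
          simpa using h
        · refine (ih hndL ht).imp_of_mem fun hL hL' hne S hS hS' => hne ?_
          obtain ⟨R, -, rfl⟩ := List.mem_map.1 hS
          obtain ⟨R', -, h⟩ := List.mem_map.1 hS'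
          refine (List.append_inj h ?_).1.symm
          rw [(leaves_spec hp d hndL ht hL).1.length_eq, (leaves_spec hp d hndL ht hL').1.length_eq]
      · have hstart : ∀ br ∈ (findStarts w p (precompute w p).val a (b :: l) t).val,
            ∀ S ∈ (leaves w p d br.left t).flatMap fun L =>
              (leaves w p d br.right (p br.job + br.start)).map fun R => L ++ br.job :: R,
            br.start = startTime p t S (pivot w p a (b :: l) t) := by
          intro br hbr S hS
          simp only [List.mem_flatMap, List.mem_map] at hS
          obtain ⟨L, hL, R, hR, rfl⟩ := hS
          obtain ⟨h1, h2, h3, -⟩ := mem_findStarts hp hnd hbr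
          have hnd' := h3.nodup_iff.2 hnd
          have hLp := (leaves_spec hp d hnd'.of_append_left ht hL).1
          rw [← h1, startTime_append_cons_self, h2, (hLp.map p).sum_eq]
          rw [hLp.mem_iff]
          exact fun h => (List.disjoint_of_nodup_append hnd') h (by simp)
        refine (findStarts_pairwise hp a (b :: l) t).imp_of_mem fun hb hb' hlt S hS hS' => ?_
        exact hlt.ne ((hstart _ hb S hS).trans (hstart _ hb' S hS').symm)

lemma finite_schedules : {S : List (Fin n) | IsSchedule S}.Finite := by
  refine ((List.finRange n).permutations.toFinset.finite_toSet).subset fun S hS => ?_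
  simpa [IsSchedule] using hS

/-- The algorithm explores at most `K` complete schedules. -/
lemma length_leaves_le_numPotential (hw : ∀ j, 0 < w j) (hp : ∀ j, 0 < p j) :
    (leaves w p n (List.finRange n) 0).length ≤ numPotential w p := by
  have hnd := List.nodup_finRange n
  rw [← List.toFinset_card_of_nodup (leaves_nodup hp n hnd le_rfl), ← Set.ncard_coe_finset]
  refine Set.ncard_le_ncard (fun S hS => ?_) (finite_schedules.subset fun S hS => hS.1)
  obtain ⟨h1, h2⟩ := leaves_spec hp n hnd le_rfl (List.mem_toFinset.1 hS)
  exact ⟨h1, h2.isPotential hw hp le_rfl⟩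

/-- In an explored call, every choice of branches extends to a complete schedule that results from
choosing branches and agrees with the branches taken before. -/
lemma Explored.exists_context (hw : ∀ j, 0 < w j) (hp : ∀ j, 0 < p j) {J : List (Fin n)} {t : ℝ}
    {Q : Set (List (Fin n))} (h : Explored w p J t Q) :
    J.Nodup ∧ 0 ≤ t ∧ ∃ d, J.length ≤ d ∧ ∃ A Z : List (Fin n), t = (A.map p).sum ∧
      ∀ S ∈ leaves w p d J t, A ++ S ++ Z ∈ Q ∧
        A ++ S ++ Z ∈ leaves w p n (List.finRange n) 0 := by
  have schedules_mem {A L R Z : List (Fin n)} {br : Branch n} {t : ℝ} (ht : t = (A.map p).sum)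
      (hs : br.start = t + (br.left.map p).sum)
      (hL : L.Perm br.left) (hR : R.Perm br.right)
      (hleaf : A ++ (L ++ br.job :: R) ++ Z ∈ leaves w p n (List.finRange n) 0) :
      A ++ (L ++ br.job :: R) ++ Z ∈ br.schedules p := by
    have hnd := (leaves_spec hp n (List.nodup_finRange n) le_rfl hleaf).1.nodup_iff.2
      (List.nodup_finRange n)
    have e : A ++ (L ++ br.job :: R) ++ Z = (A ++ L) ++ br.job :: (R ++ Z) := by simp
    refine ⟨?_, A, L, R, Z, hL, hR, by simp⟩
    rw [e] at hnd ⊢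
    rw [startTime_append_cons_self _ _ fun h => (List.disjoint_of_nodup_append hnd) h (by simp),
      hs, ht, ← (hL.map p).sum_eq]
    simp
  induction h with
  | root =>
    refine ⟨List.nodup_finRange n, le_rfl, n, by simp, [], [], by simp, fun S hS => ?_⟩
    simp only [List.nil_append, List.append_nil]
    exact ⟨(leaves_spec hp n (List.nodup_finRange n) le_rfl hS).1, hS⟩
  | @left a b l t Q br h hbr ih =>
    obtain ⟨hnd, ht, d, hd, A, Z, hA, hS⟩ := ih
    obtain ⟨d, rfl⟩ : ∃ d', d = d' + 1 := ⟨d - 1, by simp at hd; omega⟩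
    obtain ⟨-, h2, h3, -⟩ := mem_findStarts hp hnd hbr
    have hlen := Branch.length_lt h3
    have hnd' := h3.nodup_iff.2 hnd
    have hndR := (List.nodup_cons.1 hnd'.of_append_right).2
    have h0 := right_start_nonneg hp ht hnd hbr
    -- The sibling call is completed by an arbitrary leaf, which becomes part of the fixed context
    -- after the left side.
    obtain ⟨R, hR⟩ := List.exists_mem_of_ne_nil _
      (leaves_ne_nil hw hp d (J := br.right) (by omega) hndR h0)
    refine ⟨hnd'.of_append_left, ht, d, by omega, A, br.job :: R ++ Z, hA, fun L hL => ?_⟩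
    obtain ⟨hQ, hleaf⟩ := hS _ (mem_leaves_iff.2 ⟨br, hbr, L, hL, R, hR, rfl⟩)
    have hmem := schedules_mem hA h2 (leaves_spec hp d hnd'.of_append_left ht hL).1
      (leaves_spec hp d hndR h0 hR).1 hleaf
    have e : A ++ L ++ (br.job :: R ++ Z) = A ++ (L ++ br.job :: R) ++ Z := by simp
    rw [e]
    exact ⟨⟨hQ, hmem⟩, hleaf⟩
  | @right a b l t Q br h hbr ih =>
    obtain ⟨hnd, ht, d, hd, A, Z, hA, hS⟩ := ih
    obtain ⟨d, rfl⟩ : ∃ d', d = d' + 1 := ⟨d - 1, by simp at hd; omega⟩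
    obtain ⟨-, h2, h3, -⟩ := mem_findStarts hp hnd hbr
    have hlen := Branch.length_lt h3
    have hnd' := h3.nodup_iff.2 hnd
    have hndR := (List.nodup_cons.1 hnd'.of_append_right).2
    have h0 := right_start_nonneg hp ht hnd hbr
    obtain ⟨L, hL⟩ := List.exists_mem_of_ne_nil _
      (leaves_ne_nil hw hp d (J := br.left) (by omega) hnd'.of_append_left ht)
    have hLp := (leaves_spec hp d hnd'.of_append_left ht hL).1
    refine ⟨hndR, h0, d, by omega, A ++ L ++ [br.job], Z, ?_, fun R hR => ?_⟩
    · rw [h2, hA, ← (hLp.map p).sum_eq]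
      simp
      ring
    obtain ⟨hQ, hleaf⟩ := hS _ (mem_leaves_iff.2 ⟨br, hbr, L, hL, R, hR, rfl⟩)
    have hmem := schedules_mem hA h2 hLp (leaves_spec hp d hndR h0 hR).1 hleaf
    have e : A ++ L ++ [br.job] ++ R ++ Z = A ++ (L ++ br.job :: R) ++ Z := by simp
    rw [e]
    exact ⟨⟨hQ, hmem⟩, hleaf⟩

theorem Explored.exists_isPotential (hw : ∀ j, 0 < w j) (hp : ∀ j, 0 < p j) {a b : Fin n}
    {l : List (Fin n)} {t : ℝ} {Q : Set (List (Fin n))} (h : Explored w p (a :: b :: l) t Q)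
    {br : Branch n} (hbr : br ∈ (findStarts w p (precompute w p).val a (b :: l) t).val) :
    ∃ S ∈ Q ∩ br.schedules p, IsPotential w p 0 S := by
  have hE := Explored.left h hbr
  obtain ⟨hnd, ht, d, hd, A, Z, -, hS⟩ := hE.exists_context hw hp
  obtain ⟨L, hL⟩ := List.exists_mem_of_ne_nil _ (leaves_ne_nil hw hp d hd hnd ht)
  obtain ⟨h1, h2⟩ := hS L hL
  exact ⟨_, h1, (leaves_spec hp n (List.nodup_finRange n) le_rfl h2).2.isPotential hw hp le_rfl⟩

end

/-! ### Running time -/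

section

variable {n : ℕ} {β : Type}

lemma time_select_le {test : β → Timed Bool} {c : ℕ} (h : ∀ a, (test a).time ≤ c) (l : List β) :
    (select test l).time ≤ (c + 1) * l.length + 1 := by
  induction l with
  | nil => simp [select]
  | cons a l ih =>
    simp only [select, time_bind, time_tick, time_ite, time_pure, List.length_cons, ite_self]
    have := h a
    rw [Nat.mul_succ]
    omega

lemma time_append (k l : List β) : (append k l).time = k.length + 1 := by
  induction k with
  | nil => simp [append]
  | cons a k ih =>
    simp only [append, time_bind, time_tick, time_pure, List.length_cons, ih]
    omega

lemma time_split (l : List β) : (split l).time = l.length + 1 := by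
  induction l with
  | nil => simp [split]
  | cons a k ih =>
    simp only [split, time_bind, time_tick, time_pure, List.length_cons, ih]
    omega

lemma time_merge_le (key : Fin n → ℝ) (k l : List (Fin n)) :
    (merge key k l).time ≤ 4 * (k.length + l.length) + 1 := by
  induction k, l using merge.induct with
  | case1 l => simp [merge]
  | case2 a k => simp [merge]
  | case3 a k b l h1 h2 =>
    simp only [merge, time_bind, time_tick, time_ite, time_pure, time_read, time_leR,
      List.length_cons] at h1 h2 ⊢
    split_ifs <;> omega

/-- Splitting and merging cost at most 5m + 3 ≤ 8m steps, and halving with rounding up lowers the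
ceiling logarithm by one. -/
lemma time_mergeSort_le (key : Fin n → ℝ) (d : ℕ) (l : List (Fin n)) (hl : l ≠ []) :
    (mergeSort key d l).time ≤ 8 * (l.length * Nat.clog 2 l.length) + l.length := by
  induction d generalizing l with
  | zero =>
    have := List.length_pos_of_ne_nil hl
    simp only [mergeSort, time_bind, time_tick, time_pure]
    omega
  | succ d ih =>
    match l with
    | [] => exact absurd rfl hl
    | [a] => simp [mergeSort]
    | a :: b :: l =>
      have hlen := length_split (a :: b :: l)
      have hm := time_merge_le key (mergeSort key d (split (a :: b :: l)).val.1).val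
        (mergeSort key d (split (a :: b :: l)).val.2).val
      rw [(mergeSort_perm key d _).length_eq, (mergeSort_perm key d _).length_eq] at hm
      have hs := time_split (a :: b :: l)
      simp only [mergeSort, time_bind, time_tick]
      set m := (a :: b :: l).length with hm'
      have hm2 : 2 ≤ m := by simp [hm']
      have ne1 : (split (a :: b :: l)).val.1 ≠ [] := by
        rw [← List.length_pos_iff]
        omega
      have ne2 : (split (a :: b :: l)).val.2 ≠ [] := by
        rw [← List.length_pos_iff]
        omega
      have i1 := ih _ ne1
      have i2 := ih _ ne2
      rw [hlen.1] at i1 hm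
      rw [hlen.2] at i2 hm
      have hc : Nat.clog 2 m = Nat.clog 2 ((m + 1) / 2) + 1 := Nat.clog_of_two_le (by simp) hm2
      have hc' : Nat.clog 2 (m / 2) ≤ Nat.clog 2 ((m + 1) / 2) :=
        Nat.clog_mono_right 2 (by omega)
      have i3 := Nat.mul_le_mul_left (m / 2) hc'
      have hsum : (m + 1) / 2 + m / 2 = m := by omega
      have i4 : (m + 1) / 2 * Nat.clog 2 ((m + 1) / 2) + m / 2 * Nat.clog 2 ((m + 1) / 2) =
          m * Nat.clog 2 ((m + 1) / 2) := by rw [← Nat.add_mul, hsum]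
      rw [hc, Nat.mul_succ]
      omega

lemma time_sumFrom (p : Fin n → ℝ) (t : ℝ) (l : List (Fin n)) :
    (sumFrom p t l).time = 3 * l.length + 1 := by
  induction l generalizing t with
  | nil => simp [sumFrom]
  | cons a l ih =>
    simp only [sumFrom, time_bind, time_tick, time_read, time_addR, List.length_cons, ih]
    omega

lemma time_evalPhi (w p : Fin n → ℝ) (j : Fin n) (t : ℝ) : (evalPhi w p j t).time = 6 := rfl

lemma time_findAlpha_le (w p : Fin n → ℝ) (t te : ℝ) (a : Fin n) (l : List (Fin n)) :
    (findAlpha w p t te a l).time ≤ 28 * l.length + 1 := by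
  induction l generalizing a with
  | nil => simp [findAlpha]
  | cons j l ih =>
    have h1 := ih a
    have h2 := ih j
    simp only [findAlpha, time_bind, time_tick, time_ite, time_evalPhi, time_ltR, List.length_cons]
    split_ifs <;> omega

lemma time_mark (m : Fin n → Bool) (l : List (Fin n)) : (mark m l).time = 2 * l.length + 1 := by
  induction l generalizing m with
  | nil => simp [mark]
  | cons a l ih =>
    simp only [mark, time_bind, time_tick, time_write, List.length_cons, ih]
    omega

lemma time_crossesIn (T : Tables n) (α : Fin n) (t te : ℝ) (j : Fin n) :
    (crossesIn T α t te j).time = 5 := rfl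

lemma time_isBreak (T : Tables n) (α : Fin n) (t te : ℝ) (j : Fin n) :
    (isBreak T α t te j).time = 9 := rfl

lemma time_evalCrossing_le (w p : Fin n → ℝ) (i j : Fin n) : (evalCrossing w p i j).time ≤ 13 := by
  simp only [evalCrossing, time_bind, time_tick, time_ite, time_read, time_mulR, time_subR,
    time_divR, time_eqR, time_pure]
  split_ifs <;> omega

lemma time_fill_le {f : Fin n → Timed β} {c : ℕ} (h : ∀ i, (f i).time ≤ c) :
    (fill f).time ≤ 1 + n * (c + 1) := by
  rw [time_fill]
  have := Finset.sum_le_card_nsmul Finset.univ (fun i => (f i).time + 1) (c + 1)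
    (fun i _ => Nat.succ_le_succ (h i))
  simp only [Finset.card_univ, Fintype.card_fin, smul_eq_mul] at this
  omega

/-- An amortised bound: each dropped interval pays for the at most 7 steps of its iteration, so over
a whole scan the sweeps cost linear time. The 4 covers the iteration that stops. -/
lemma time_sweep_le (T : Tables n) (α : Fin n) (s : ℝ) (bans : List (Fin n)) (m : ℝ) :
    (sweep T α s bans m).time + 7 * (sweep T α s bans m).val.1.length ≤ 7 * bans.length + 4 := by
  induction bans generalizing m with
  | nil => simp [sweep]
  | cons j l ih =>
    simp only [sweep, time_bind, val_bind, time_ite, val_ite, time_tick, time_read, time_leR,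
      time_ltR, time_pure, val_pure, List.length_cons]
    have h1 := ih m
    split_ifs
    · have h2 := ih ((read (read T.exit α).val j).val)
      omega
    · omega
    · simp only [List.length_cons]
      omega

/-- Each point costs at most 8 steps of its own and the unamortised 4 of its sweep; the remainder is
paid by the intervals. -/
lemma time_scan_le (p : Fin n → ℝ) (T : Tables n) (α : Fin n) (te : ℝ) (bs : List (Fin n))
    (c s : ℝ) (left right bans : List (Fin n)) (m : ℝ) :
    (scan p T α te bs c s left right bans m).time ≤ 12 * (bs.length + 1) + 7 * bans.length := by
  induction bs generalizing c s left right bans m with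
  | nil =>
    have h := time_sweep_le T α s bans m
    simp only [scan, time_bind, time_ite, time_tick, time_leR, time_ltR, time_pure, ite_self,
      List.length_nil]
    omega
  | cons j bs ih =>
    have h := time_sweep_le T α s bans m
    have h2 := ih (read (read T.exit α).val j).val (addR s (read p j).val).val (j :: left)
      right.tail (sweep T α s bans m).val.1 (sweep T α s bans m).val.2
    simp only [scan, time_bind, time_ite, time_tick, time_leR, time_ltR, time_pure, ite_self,
      time_read, time_addR, List.length_cons]
    omega

lemma length_le_of_nodup {l : List (Fin n)} (h : l.Nodup) : l.length ≤ n := by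
  simpa using h.length_le_card

lemma time_findStarts_le (w p : Fin n → ℝ) {a : Fin n} {l : List (Fin n)} (t : ℝ)
    (hnd : (a :: l).Nodup) :
    (findStarts w p (precompute w p).val a l t).time ≤ 150 * n := by
  have hlen := length_le_of_nodup hnd
  rw [List.length_cons] at hlen
  have hE (i : Fin n) : ((precompute w p).val.byExit i).length = n := by
    rw [val_precompute]
    simp [(mergeSort_perm _ _ _).length_eq]
  have hC (i : Fin n) : ((precompute w p).val.byCross i).length = n := by
    rw [val_precompute]
    simp [(mergeSort_perm _ _ _).length_eq]
  simp only [findStarts, time_bind, time_tick, time_sumFrom, time_mark, time_write, time_read,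
    time_append, val_select, val_read, List.length_cons]
  have h1 := time_findAlpha_le w p t (sumFrom p t (a :: l)).val a l
  set α := (findAlpha w p t (sumFrom p t (a :: l)).val a l).val
  set te := (sumFrom p t (a :: l)).val
  set T := (precompute w p).val
  have h2 : (fill fun _ : Fin n => (pure false : Timed Bool)).time ≤ 1 + n * (0 + 1) :=
    time_fill_le (by simp)
  set M := (write (mark (fill fun _ : Fin n => (pure false : Timed Bool)).val (a :: l)).val α
    false).val
  have h3 := time_select_le (test := fun j => do
    let b ← read M j
    let b' ← isBreak T α t te j
    return b && b') (c := 10) (fun j => by simp [time_isBreak]) (T.byExit α)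
  have h4 := time_select_le (test := fun j => do
    let b ← read M j
    let b' ← crossesIn T α t te j
    return b && b') (c := 6) (fun j => by simp [time_crossesIn]) (T.byCross α)
  have h5 := time_select_le (test := fun j => do
    let b ← eqIdx j α
    let b' ← isBreak T α t te j
    return !b && !b') (c := 10) (fun j => by simp [time_isBreak]) (a :: l)
  rw [hE] at h3
  rw [hC] at h4
  rw [List.length_cons] at h5
  have h6 := time_scan_le p T α te
    ((T.byExit α).filter fun j => (do
      let b ← read M j
      let b' ← isBreak T α t te j
      return b && b' : Timed Bool).val) t t []
    (append ((T.byExit α).filter fun j => (do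
      let b ← read M j
      let b' ← isBreak T α t te j
      return b && b' : Timed Bool).val)
      ((a :: l).filter fun j => (do
      let b ← eqIdx j α
      let b' ← isBreak T α t te j
      return !b && !b' : Timed Bool).val)).val
    ((T.byCross α).filter fun j => (do
      let b ← read M j
      let b' ← crossesIn T α t te j
      return b && b' : Timed Bool).val) t
  have h7 := List.length_filter_le (fun j => (do
      let b ← read M j
      let b' ← isBreak T α t te j
      return b && b' : Timed Bool).val) (T.byExit α)
  have h8 := List.length_filter_le (fun j => (do
      let b ← read M j
      let b' ← crossesIn T α t te j
      return b && b' : Timed Bool).val) (T.byCross α)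
  rw [hE] at h7
  rw [hC] at h8
  omega

/-- The precomputation takes `O(n² log n)` steps. -/
lemma time_precompute_le (w p : Fin n → ℝ) (hn : 1 ≤ n) :
    (precompute w p).time ≤ 16 * (n * n * Nat.clog 2 n) + 40 * (n * n) := by
  have h1 : (fill fun i => fill fun j => evalCrossing w p i j).time ≤
      1 + n * ((1 + n * (13 + 1)) + 1) :=
    time_fill_le fun i => time_fill_le fun j => time_evalCrossing_le w p i j
  have h2 (cross : Fin n → Fin n → ℝ) : (fill fun i => fill fun j => (do
      let row ← read cross i
      let x ← read row j
      let pj ← read p j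
      addR x pj : Timed ℝ)).time ≤ 1 + n * ((1 + n * (4 + 1)) + 1) :=
    time_fill_le fun i => time_fill_le fun j => by simp
  have h3 (cross : Fin n → Fin n → ℝ) : (fill fun i => (do
      let row ← read cross i
      let all ← allJobs n
      mergeSort row n all : Timed (List (Fin n)))).time ≤
      1 + n * ((8 * (n * Nat.clog 2 n) + 2 * n + 2) + 1) :=
    time_fill_le fun i => by
      have := time_mergeSort_le (cross i) n (List.finRange n) (by
        rw [← List.length_pos_iff, List.length_finRange]
        exact hn)
      simp only [List.length_finRange] at this
      simp only [time_bind, time_read, time_allJobs, val_read, val_allJobs]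
      omega
  simp only [precompute, time_bind, time_tick, time_pure]
  have h2' := h2 (fill fun i => fill fun j => evalCrossing w p i j).val
  have h3' := h3 (fill fun i => fill fun j => evalCrossing w p i j).val
  have h3'' := h3 (fill fun i => fill fun j => (do
      let row ← read (fill fun i => fill fun j => evalCrossing w p i j).val i
      let x ← read row j
      let pj ← read p j
      addR x pj : Timed ℝ)).val
  have h4 : n ≤ n * n := Nat.le_mul_self n
  have e1 : n * ((1 + n * (13 + 1)) + 1) = 14 * (n * n) + 2 * n := by ring
  have e2 : n * ((1 + n * (4 + 1)) + 1) = 5 * (n * n) + 2 * n := by ring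
  have e3 : n * ((8 * (n * Nat.clog 2 n) + 2 * n + 2) + 1) =
    8 * (n * n * Nat.clog 2 n) + 2 * (n * n) + 3 * n := by ring
  rw [e1] at h1
  rw [e2] at h2'
  rw [e3] at h3' h3''
  omega

lemma time_foldlM_le {γ : Type} {f : β → γ → Timed β} {g : γ → ℕ} {l : List γ}
    (h : ∀ b, ∀ c ∈ l, (f b c).time ≤ g c) (b : β) :
    (l.foldlM f b).time ≤ (l.map g).sum := by
  induction l generalizing b with
  | nil => simp
  | cons c l ih =>
    have h1 := h b c (by simp)
    have h2 := ih (fun b c hc => h b c (by simp [hc])) (f b c).val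
    simp only [List.foldlM_cons, time_bind, List.map_cons, List.sum_cons]
    omega

variable {w p : Fin n → ℝ}

lemma length_leaves (d : ℕ) (a b : Fin n) (l : List (Fin n)) (t : ℝ) :
    (leaves w p (d + 1) (a :: b :: l) t).length =
      ((findStarts w p (precompute w p).val a (b :: l) t).val.map fun br =>
        (leaves w p d br.left t).length *
          (leaves w p d br.right (p br.job + br.start)).length).sum := by
  simp [leaves, List.length_flatMap]

/-- The running time of `FastSchedule` is linear in the number of schedules it explores. -/
lemma time_fastSchedule_le (hw : ∀ j, 0 < w j) (hp : ∀ j, 0 < p j) (hn : 1 ≤ n) (d : ℕ)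
    {J : List (Fin n)} {t : ℝ} (hd : J.length ≤ d) (hnd : J.Nodup) (ht : 0 ≤ t) :
    (fastSchedule w p (precompute w p).val d J t).time ≤
      161 * n * ((2 * J.length + 1) * (leaves w p d J t).length) := by
  induction d generalizing J t with
  | zero =>
    obtain rfl := List.length_eq_zero_iff.1 (Nat.le_zero.1 hd)
    simp [fastSchedule, leaves]
    omega
  | succ d ih =>
    match J with
    | [] =>
      simp [fastSchedule, leaves]
      omega
    | [j] =>
      simp [fastSchedule, leaves]
      omega
    | a :: b :: l =>
      have hleaf := length_leaves (w := w) (p := p) d a b l t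
      have hpos := List.length_pos_of_ne_nil (leaves_ne_nil hw hp (d + 1) hd hnd ht)
      set m := (a :: b :: l).length with hm
      set K := (leaves w p (d + 1) (a :: b :: l) t).length
      have hfold := time_foldlM_le (f := fun (best : ℝ × List (Fin n)) (br : Branch n) => (do
          tick
          let wα ← read w br.job
          let pα ← read p br.job
          let c ← addR pα br.start
          let optL ← fastSchedule w p (precompute w p).val d br.left t
          let optR ← fastSchedule w p (precompute w p).val d br.right c
          let v₁ ← addR optL.1 optR.1
          let v₂ ← divR wα c
          let v ← addR v₁ v₂
          if ← ltR best.1 v then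
            let seq ← append optL.2 (br.job :: optR.2)
            return (v, seq)
          else return best : Timed (ℝ × List (Fin n))))
        (l := (findStarts w p (precompute w p).val a (b :: l) t).val)
        (g := fun br => (161 * n * (2 * m) + 10 * n) * ((leaves w p d br.left t).length *
          (leaves w p d br.right (p br.job + br.start)).length)) (fun best br hbr => by
            obtain ⟨-, -, h3, -⟩ := mem_findStarts hp hnd hbr
            have hlen := Branch.length_lt h3
            have hnd' := h3.nodup_iff.2 hnd
            have hndL := hnd'.of_append_left
            have hndR := (List.nodup_cons.1 hnd'.of_append_right).2
            have h0 := right_start_nonneg hp ht hnd hbr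
            have i1 := ih (J := br.left) (by omega) hndL ht
            have i2 := ih (J := br.right) (by omega) hndR h0
            have kl := List.length_pos_of_ne_nil
              (leaves_ne_nil hw hp d (J := br.left) (by omega) hndL ht)
            have kr := List.length_pos_of_ne_nil
              (leaves_ne_nil hw hp d (J := br.right) (by omega) hndR h0)
            -- Joining the sequences costs the length of the left one, so a branch has overhead at
            -- most n + 9 ≤ 10n besides its recursive calls.
            have hout := length_le_of_nodup ((fastSchedule_isBest hw hp d br.left t (by omega)
              hndL ht).1.1.nodup_iff.2 hndL)
            have hsize := h3.length_eq
            simp only [time_bind, time_tick, time_ite, time_read, time_addR, time_divR, time_ltR,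
              time_append, time_pure, val_read, val_addR]
            set x := (leaves w p d br.left t).length
            set y := (leaves w p d br.right (p br.job + br.start)).length
            -- As neither side is a dead end, each leaf count is at most the product, which counts
            -- the leaves of the branch.
            have hx : x ≤ x * y := Nat.le_mul_of_pos_right x kr
            have hy : y ≤ x * y := Nat.le_mul_of_pos_left y kl
            have hxy : 1 ≤ x * y := Nat.le_trans kl hx
            have j1 : 161 * n * ((2 * br.left.length + 1) * x) ≤
                161 * n * ((2 * br.left.length + 1) * (x * y)) := by gcongr
            have j2 : 161 * n * ((2 * br.right.length + 1) * y) ≤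
                161 * n * ((2 * br.right.length + 1) * (x * y)) := by gcongr
            have j3 : 10 * n * 1 ≤ 10 * n * (x * y) := Nat.mul_le_mul_left _ hxy
            have hm' : m = br.left.length + br.right.length + 1 := by
              rw [hm, ← hsize, List.length_append, List.length_cons]
              omega
            -- The job α accounts for the two summands 1: (2m_l + 1) + (2m_r + 1) = 2m.
            have e : (161 * n * (2 * m) + 10 * n) * (x * y) =
                161 * n * ((2 * br.left.length + 1) * (x * y)) +
                161 * n * ((2 * br.right.length + 1) * (x * y)) + 10 * n * (x * y) := by
              rw [hm']
              ring
            rw [e]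
            split_ifs <;> omega) (0, [])
      have htime : (fastSchedule w p (precompute w p).val (d + 1) (a :: b :: l) t).time ≤
          1 + 150 * n + (161 * n * (2 * m) + 10 * n) * K := by
        rw [hleaf, ← List.sum_map_mul_left]
        have hs := time_findStarts_le w p t hnd
        rw [fastSchedule, time_bind, time_bind, time_tick]
        refine le_trans ?_ (Nat.add_le_add (Nat.add_le_add_left hs 1) hfold)
        rw [Nat.add_assoc]
      refine htime.trans ?_
      -- Here 161 = 10 + 151: 10 for the overhead per branch, 151 for the start-time search and the
      -- tick, charged to the at least one leaf.
      have e : 161 * n * ((2 * m + 1) * K) = (161 * n * (2 * m) + 10 * n) * K + 151 * n * K := by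
        ring
      have : 151 * n * 1 ≤ 151 * n * K := Nat.mul_le_mul_left _ hpos
      omega

lemma clog_le_log (hn : 2 ≤ n) : (Nat.clog 2 n : ℝ) ≤ 2 / Real.log 2 * Real.log n := by
  have h2 : 0 < Real.log 2 := Real.log_pos one_lt_two
  have h1 : Nat.clog 2 n ≤ Nat.log 2 n + 1 := by
    refine Nat.clog_le_of_le_pow (Nat.lt_pow_succ_log_self one_lt_two n).le
  have h3 : (Nat.log 2 n : ℝ) ≤ Real.log n / Real.log 2 := Real.natLog_le_logb n 2
  have h4 : 1 ≤ Real.log n / Real.log 2 := by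
    rw [le_div_iff₀ h2, one_mul]
    exact Real.log_le_log two_pos (by exact_mod_cast hn)
  have h5 : (Nat.clog 2 n : ℝ) ≤ Nat.log 2 n + 1 := by exact_mod_cast h1
  have e : 2 / Real.log 2 * Real.log n = Real.log n / Real.log 2 + Real.log n / Real.log 2 := by
    ring
  rw [e]
  linarith

/-- The ceiling logarithm is at least 1, so 16 + 40 = 56 of it suffice; bounding it by twice the
binary logarithm gives 112. -/
lemma time_precompute_le_log (w p : Fin n → ℝ) (hn : 2 ≤ n) :
    ((precompute w p).time : ℝ) ≤ 112 / Real.log 2 * ((n : ℝ) ^ 2 * Real.log n) := by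
  have h1 : ((precompute w p).time : ℝ) ≤
      16 * ((n : ℝ) * n * Nat.clog 2 n) + 40 * ((n : ℝ) * n) := by
    exact_mod_cast time_precompute_le w p (by omega)
  have h2 := clog_le_log hn
  have h3 : (1 : ℝ) ≤ Nat.clog 2 n := by
    exact_mod_cast Nat.clog_pos one_lt_two hn
  have h4 : (n : ℝ) * n * 1 ≤ n * n * Nat.clog 2 n := by gcongr
  have h5 : (n : ℝ) * n * Nat.clog 2 n ≤ n * n * (2 / Real.log 2 * Real.log n) := by gcongr
  have e : 112 / Real.log 2 * ((n : ℝ) ^ 2 * Real.log n) =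
      56 * (n * n * (2 / Real.log 2 * Real.log n)) := by ring
  rw [e]
  linarith

lemma time_solve_le (hw : ∀ j, 0 < w j) (hp : ∀ j, 0 < p j) (hn : 1 ≤ n) :
    ((solve w p).time : ℝ) ≤
      (112 / Real.log 2 + 1000) * ((n : ℝ) ^ 2 * (Real.log n + numPotential w p)) := by
  have hnd := List.nodup_finRange n
  have hK := length_leaves_le_numPotential hw hp (w := w) (p := p)
  have hpos := List.length_pos_of_ne_nil
    (leaves_ne_nil hw hp n (List.length_finRange.le) hnd le_rfl)
  have hfast := time_fastSchedule_le hw hp hn n (List.length_finRange.le) hnd le_rfl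
  rw [List.length_finRange] at hfast
  have hK1 : (1 : ℝ) ≤ numPotential w p := by exact_mod_cast Nat.le_trans hpos hK
  have hn1 : (1 : ℝ) ≤ n := by exact_mod_cast hn
  have hpre : ((precompute w p).time : ℝ) ≤
      112 / Real.log 2 * ((n : ℝ) ^ 2 * Real.log n) + 40 * ((n : ℝ) ^ 2 * numPotential w p) := by
    -- For n = 1 the logarithm vanishes, and the precomputation is charged to K ≥ 1 instead.
    rcases hn.eq_or_lt with h | h
    · subst h
      have h1 : ((precompute w p).time : ℝ) ≤ 40 := by
        exact_mod_cast (time_precompute_le w p le_rfl).trans (by simp)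
      simp
      linarith
    · have := time_precompute_le_log w p h
      have h0 : 0 ≤ 40 * ((n : ℝ) ^ 2 * numPotential w p) := by positivity
      linarith
  have hfast' : ((fastSchedule w p (precompute w p).val n (List.finRange n) 0).time : ℝ) ≤
      483 * ((n : ℝ) ^ 2 * numPotential w p) := by
    have h1 : ((fastSchedule w p (precompute w p).val n (List.finRange n) 0).time : ℝ) ≤
        161 * n * ((2 * n + 1) * numPotential w p) := by
      refine le_trans (b := ((161 * n * ((2 * n + 1) *
        (leaves w p n (List.finRange n) 0).length) : ℕ) : ℝ)) (by exact_mod_cast hfast) ?_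
      push_cast
      gcongr
    have h2 : 161 * n * ((2 * n + 1) * numPotential w p) ≤
        161 * (n : ℝ) * ((2 * n + n) * numPotential w p) := by gcongr
    linarith
  have htime : ((solve w p).time : ℝ) = 1 + ((precompute w p).time + ((n + 1) +
      (fastSchedule w p (precompute w p).val n (List.finRange n) 0).time)) := by
    have : (solve w p).time = 1 + ((precompute w p).time + ((n + 1) +
      (fastSchedule w p (precompute w p).val n (List.finRange n) 0).time)) := rfl
    exact_mod_cast this
  have h1 : (n : ℝ) ≤ n ^ 2 * numPotential w p := by nlinarith
  have hlog : 0 ≤ (n : ℝ) ^ 2 * Real.log n := mul_nonneg (by positivity) (Real.log_nonneg hn1)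
  have hc : 0 < 112 / Real.log 2 := div_pos (by norm_num) (Real.log_pos one_lt_two)
  have hcK : 0 ≤ 112 / Real.log 2 * ((n : ℝ) ^ 2 * numPotential w p) := by positivity
  rw [htime, mul_add, mul_add, add_mul, add_mul]
  linarith

end

end

end Refueling

theorem mainTheorem2 :
    (∀ (n : ℕ) (w p : Fin n → ℝ), (∀ j, 0 < w j) → (∀ j, 0 < p j) →
      Refueling.IsOptimal w p (Refueling.solve w p).val.2 ∧
      (Refueling.solve w p).val.1 = -Refueling.cost w p 0 (Refueling.solve w p).val.2) ∧
    (∃ C : ℝ, ∀ (n : ℕ) (w p : Fin n → ℝ), 1 ≤ n → (∀ j, 0 < w j) → (∀ j, 0 < p j) →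
      ((Refueling.solve w p).time : ℝ) ≤
        C * ((n : ℝ) ^ 2 * (Real.log n + Refueling.numPotential w p)) ∧
      (2 ≤ n → ((Refueling.precompute w p).time : ℝ) ≤ C * ((n : ℝ) ^ 2 * Real.log n)) ∧
      (∀ (a : Fin n) (l : List (Fin n)) (t : ℝ), (a :: l).Nodup →
        ((Refueling.findStarts w p (Refueling.precompute w p).val a l t).time : ℝ) ≤ C * n)) ∧
    (∀ (n : ℕ) (w p : Fin n → ℝ), (∀ j, 0 < w j) → (∀ j, 0 < p j) →
      ∀ (a b : Fin n) (l : List (Fin n)) (t : ℝ) (Q : Set (List (Fin n))),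
        Refueling.Explored w p (a :: b :: l) t Q →
        ∀ br ∈ (Refueling.findStarts w p (Refueling.precompute w p).val a (b :: l) t).val,
          ∃ S ∈ Q ∩ br.schedules p, Refueling.IsPotential w p 0 S) := by
  have hc : 0 < 112 / Real.log 2 := div_pos (by norm_num) (Real.log_pos one_lt_two)
  refine ⟨fun n w p hw hp => Refueling.solve_isOptimal hw hp,
    ⟨112 / Real.log 2 + 1000, fun n w p hn hw hp =>
      ⟨Refueling.time_solve_le hw hp hn, fun h2 => ?_, fun a l t hnd => ?_⟩⟩,
    fun n w p hw hp a b l t Q h br hbr => h.exists_isPotential hw hp hbr⟩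
  · refine (Refueling.time_precompute_le_log w p h2).trans ?_
    have hlog := Real.log_nonneg (x := n) (by exact_mod_cast hn)
    gcongr
    linarith
  · have h1 : ((Refueling.findStarts w p (Refueling.precompute w p).val a l t).time : ℝ) ≤
        150 * n := by exact_mod_cast Refueling.time_findStarts_le w p t hnd
    refine h1.trans ?_
    gcongr
    linarith
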